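/- Let $D\subset\mathbb{C}^n$ be open (for instance a domain), with coordinates $z^k$, and let $(z,\eta)$ be the induced coordinates on $T'D=D\times\mathbb{C}^n$. A complex Finsler metric on $D$ is a continuous $F:T'D\to[0,\infty)$, smooth for $\eta\ne0$, with $F(z,\eta)=0$ iff $\eta=0$, $F(z,\lambda\eta)=|\lambda|F(z,\eta)$ for $\lambda\in\mathbb{C}$, and with $g_{i\bar j}=\partial^2F^2/\partial\eta^i\partial\bar\eta^j$ Hermitian positive definite for $\eta\neq 0$. With the summation convention, put, for $\eta\ne0$, $$N^i_j=g^{\bar mi}\frac{\partial g_{l\bar m}}{\partial z^j}\eta^l,\quad G^i=\tfrac12N^i_j\eta^j,\quad T^i_{jk}=\frac{\partial N^i_k}{\partial\eta^j}-\frac{\partial N^i_j}{\partial\eta^k},\quad \theta^{*k}=g^{\bar mk}g_{h\bar p}\overline{T^p_{jm}}\,\eta^h\bar\eta^j .$$ $F$ is complex Berwald if it is generalized Berwald ($\partial G^i/\partial\bar\eta^h=0$) and weakly Kähler ($g_{i\bar l}T^i_{jk}\eta^j\bar\eta^l=0$). Two complex Finsler metrics $F,\tilde F$ on $D$ are projectively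 related if there is a smooth function $P:D\times(\mathbb{C}^n\setminus\{0\})\to\mathbb{C}$ with $$\tilde G^i=G^i+\tfrac12(\tilde\theta^{*i}-\theta^{*i})+P\eta^i .$$ A metric is locally Minkowski if around every point there is a holomorphic chart in which its fundamental tensor $g_{i\bar j}$ depends only on $\eta$. $F$ is locally projectively flat if every point of $D$ has an open neighbourhood $U\subset D$ on which $F$ is projectively related to a locally Minkowski complex Finsler metric on $U$. **Theorem 2.4.** Let $F$ be a complex Finsler metric on $D$. 1. (In the coordinates of $D$.) $F$ is projectively related on $D$ to a complex Finsler metric whose fundamental tensor, in the coordinates $z$, depends only on $\eta$, if and only if $F$ is complex Berwald and, for all $z\in D$, $\eta\neq0$ and all $i$, $$G^i=\frac1F\frac{\partial F}{\partial z^k}\eta^k\eta^i. \qquad(*)$$ 2. (In local charts.) $F$ is locally projectively flat if and only if $F$ is complex Berwald and every point of $D$ has a holomorphic chart around it, with domain in $D$, in whose induced coordinates $(*)$ holds. -/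

import Mathlib

open scoped ContDiff ComplexConjugate ComplexOrder

noncomputable section

namespace ComplexFinsler

/-- The complex coordinate space `ℂⁿ`; only its topology and its linear structure are used. -/
abbrev CVec (n : ℕ) : Type := Fin n → ℂ

/-- Points `(z, η)` of the holomorphic tangent bundle of `ℂⁿ`. -/
abbrev TVec (n : ℕ) : Type := CVec n × CVec n

variable {n : ℕ}

/-- The holomorphic tangent bundle of `D` with the zero section removed. -/
def slit (D : Set (CVec n)) : Set (TVec n) := {x | x.1 ∈ D ∧ x.2 ≠ 0}

/-- Wirtinger derivative of type `(1,0)` in the complex direction `v`. -/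
def wirt (v : TVec n) (f : TVec n → ℂ) (x : TVec n) : ℂ :=
  (1 / 2) * (fderiv ℝ f x v - Complex.I * fderiv ℝ f x (Complex.I • v))

/-- Wirtinger derivative of type `(0,1)` in the complex direction `v`. -/
def wirtBar (v : TVec n) (f : TVec n → ℂ) (x : TVec n) : ℂ :=
  (1 / 2) * (fderiv ℝ f x v + Complex.I * fderiv ℝ f x (Complex.I • v))

/-- `∂f/∂z^k`. -/
def dz (k : Fin n) (f : TVec n → ℂ) : TVec n → ℂ := wirt (Pi.single k 1, 0) f

/-- `∂f/∂η^k`. -/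
def dEta (k : Fin n) (f : TVec n → ℂ) : TVec n → ℂ := wirt (0, Pi.single k 1) f

/-- `∂f/∂η̄^k`. -/
def dEtaBar (k : Fin n) (f : TVec n → ℂ) : TVec n → ℂ := wirtBar (0, Pi.single k 1) f

/-- The fundamental tensor `g_{i j̄} = ∂²F²/∂η^i∂η̄^j` (row `i`, column `j`). -/
def gMat (F : TVec n → ℝ) (x : TVec n) : Matrix (Fin n) (Fin n) ℂ :=
  Matrix.of fun i j => dEta i (dEtaBar j fun y => ((F y ^ 2 : ℝ) : ℂ)) x

/-- `F` is a complex Finsler metric on `D`. -/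
structure IsComplexFinslerMetric (F : TVec n → ℝ) (D : Set (CVec n)) : Prop where
  continuousOn : ContinuousOn F (D ×ˢ Set.univ)
  smooth : ContDiffOn ℝ ∞ F (slit D)
  nonneg : ∀ z ∈ D, ∀ η, 0 ≤ F (z, η)
  eq_zero_iff : ∀ z ∈ D, ∀ η, F (z, η) = 0 ↔ η = 0
  homogeneous : ∀ z ∈ D, ∀ (c : ℂ) (η : CVec n), F (z, c • η) = ‖c‖ * F (z, η)
  posDef : ∀ x ∈ slit D, (gMat F x).PosDef

/-- Coefficients `N^i_j = g^{m̄ i} (∂g_{l m̄}/∂z^j) η^l` of the Chern-Finsler connection;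
`(gMat F x)⁻¹ m i` is `g^{m̄ i}`, that is `∑ m, g_{j m̄} g^{m̄ i} = δ_j^i`. -/
def chernN (F : TVec n → ℝ) (i j : Fin n) (x : TVec n) : ℂ :=
  ∑ m, ∑ l, (gMat F x)⁻¹ m i * dz j (fun y => gMat F y l m) x * x.2 l

/-- Spray coefficients `G^i`, where `2 G^i = N^i_j η^j`. -/
def spray (F : TVec n → ℝ) (i : Fin n) (x : TVec n) : ℂ :=
  (1 / 2) * ∑ j, chernN F i j x * x.2 j

/-- `L^i_{jk} = ∂N^i_k/∂η^j`. -/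
def chernL (F : TVec n → ℝ) (i j k : Fin n) (x : TVec n) : ℂ :=
  dEta j (chernN F i k) x

/-- Torsion `T^i_{jk} = L^i_{jk} - L^i_{kj}`. -/
def torsion (F : TVec n → ℝ) (i j k : Fin n) (x : TVec n) : ℂ :=
  chernL F i j k x - chernL F i k j x

/-- `θ^{*k} = g^{m̄ k} g_{h p̄} (L^{p̄}_{j̄ m̄} - L^{p̄}_{m̄ j̄}) η^h η̄^j`. -/
def thetaStar (F : TVec n → ℝ) (k : Fin n) (x : TVec n) : ℂ :=
  ∑ m, ∑ h, ∑ p, ∑ j,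
    (gMat F x)⁻¹ m k * gMat F x h p * conj (torsion F p j m x) * x.2 h * conj (x.2 j)

/-- Generalized Berwald: the spray coefficients are holomorphic in `η`. -/
def IsGeneralizedBerwald (F : TVec n → ℝ) (D : Set (CVec n)) : Prop :=
  ∀ x ∈ slit D, ∀ i h, dEtaBar h (spray F i) x = 0

/-- Weakly Kähler: `g_{i l̄} T^i_{jk} η^j η̄^l = 0`. -/
def IsWeaklyKahler (F : TVec n → ℝ) (D : Set (CVec n)) : Prop :=
  ∀ x ∈ slit D, ∀ k,
    ∑ i, ∑ j, ∑ l, gMat F x i l * torsion F i j k x * x.2 j * conj (x.2 l) = 0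

/-- Complex Berwald: generalized Berwald and weakly Kähler. -/
def IsComplexBerwald (F : TVec n → ℝ) (D : Set (CVec n)) : Prop :=
  IsGeneralizedBerwald F D ∧ IsWeaklyKahler F D

/-- `F` and `F'` are projectively related on `D`: there is a projective change
`G'^i = G^i + B^i + P η^i`, where `B^i = (θ'^{*i} - θ^{*i}) / 2` and `P` is a smooth
complex-valued function. -/
def ProjectivelyRelated (F F' : TVec n → ℝ) (D : Set (CVec n)) : Prop :=
  ∃ P : TVec n → ℂ, ContDiffOn ℝ ∞ P (slit D) ∧
    ∀ x ∈ slit D, ∀ i,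
      spray F' i x
        = spray F i x + (1 / 2) * (thetaStar F' i x - thetaStar F i x) + P x * x.2 i

/-- `φ` is a holomorphic chart of `D` around `p`. -/
structure IsChartAt (φ : OpenPartialHomeomorph (CVec n) (CVec n)) (D : Set (CVec n))
    (p : CVec n) : Prop where
  mem_source : p ∈ φ.source
  source_subset : φ.source ⊆ D
  holomorphic : AnalyticOnNhd ℂ φ φ.source
  holomorphic_symm : AnalyticOnNhd ℂ φ.symm φ.target

/-- The expression of `F` in the coordinates `(w, ζ)` that the chart `φ` induces on the
holomorphic tangent bundle. -/
def inChart (φ : OpenPartialHomeomorph (CVec n) (CVec n)) (F : TVec n → ℝ) : TVec n → ℝ :=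
  fun x => F (φ.symm x.1, fderiv ℂ φ.symm x.1 x.2)

/-- In the given coordinates the fundamental tensor of `F` depends only on `η`. -/
def IsMinkowskiInCoords (F : TVec n → ℝ) (D : Set (CVec n)) : Prop :=
  ∀ z ∈ D, ∀ z' ∈ D, ∀ η : CVec n, η ≠ 0 → gMat F (z, η) = gMat F (z', η)

/-- Locally Minkowski: around every point there is a holomorphic chart in which the
fundamental tensor depends only on `η`. -/
def IsLocallyMinkowski (F : TVec n → ℝ) (D : Set (CVec n)) : Prop :=
  ∀ p ∈ D, ∃ φ : OpenPartialHomeomorph (CVec n) (CVec n),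
    IsChartAt φ D p ∧ IsMinkowskiInCoords (inChart φ F) φ.target

/-- Locally projectively flat: near every point, `F` is projectively related to a locally
Minkowski complex Finsler metric. -/
def IsLocallyProjectivelyFlat (F : TVec n → ℝ) (D : Set (CVec n)) : Prop :=
  ∀ p ∈ D, ∃ U : Set (CVec n), IsOpen U ∧ p ∈ U ∧ U ⊆ D ∧
    ∃ F' : TVec n → ℝ, IsComplexFinslerMetric F' U ∧ IsLocallyMinkowski F' U ∧
      ProjectivelyRelated F F' U

/-- Projectively flat with respect to the given coordinates: `F` is projectively related to a
complex Finsler metric whose fundamental tensor depends only on `η` in these coordinates. -/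
def IsProjectivelyFlatInCoords (F : TVec n → ℝ) (D : Set (CVec n)) : Prop :=
  ∃ F' : TVec n → ℝ, IsComplexFinslerMetric F' D ∧ IsMinkowskiInCoords F' D ∧
    ProjectivelyRelated F F' D

/-- The identity `G^i = (1/F) (∂F/∂z^k) η^k η^i` in the given coordinates. -/
def SprayIdentity (F : TVec n → ℝ) (D : Set (CVec n)) : Prop :=
  ∀ x ∈ slit D, ∀ i,
    spray F i x = 1 / (F x : ℂ) * (∑ k, dz k (fun y => (F y : ℂ)) x * x.2 k) * x.2 i

end ComplexFinsler

end

/-! Write `E = F²`, `E_i = ∂E/∂η^i`, `E_m̄ = ∂E/∂η̄^m` and `q = (1/F)(∂F/∂z^k)η^k`. Homogeneity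
turns every object into derivatives of `E`. Euler's relation gives `g_{l m̄} η^l = E_m̄`, hence `2
g_{i m̄} G^i = η^j ∂E_m̄/∂z^j` and `2 E_i G^i = η^k ∂E/∂z^k = 2qE`. The torsion covector becomes
`κ_k = 2(∂E/∂z^k - E_i ∂G^i/∂η^k)` (`kahlerForm_eq`). Lowering the index of `θ*` gives the conjugate
of `κ`, so weakly Kähler means `θ* = 0`; moreover `κ_k η^k = 0`, so `E_i θ*^i = 0`.

A Minkowski metric has zero spray and zero `θ*` in its coordinates. Projective relation to one
therefore reads `G - θ*/2 + Pη = 0`. Contraction with `E_i` gives `P = -q`. Under `η ↦ cη` the terms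
`G` and `qη` scale by `c²`, but `θ*` by `|c|²`; taking `c = i` separates them, so `θ* = 0` and `G =
qη`. Applying `∂/∂η̄^l` to `2qE = η^k ∂E/∂z^k` and comparing with the lowered spray leaves `E
∂q/∂η̄^l = 0`, so the spray is holomorphic in `η`. Conversely, `θ* = 0` and `G = qη` relate `F` to
the Euclidean metric, with `P = -q`.

The local statement follows by working in a chart. The spray transforms with a Hessian term
(`fderiv_symm_spray_inChart`) that depends on the chart only and is holomorphic. It therefore
cancels between two metrics, disappears under `∂/∂η̄`, and cancels in `κ`. Thus projective relation
and the complex Berwald property do not depend on the chart. -/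

open scoped ContDiff ComplexConjugate ComplexOrder
noncomputable section
namespace ComplexFinsler
variable {n : ℕ}

/-! ### Wirtinger calculus and Euler's relations -/

section Wirtinger

variable {f g : TVec n → ℂ} {x : TVec n} {v w : TVec n}

/-- The `(1,0)`-part of the real differential, as a complex-linear map of the direction. -/
def wirtLin (f : TVec n → ℂ) (x : TVec n) : TVec n →ₗ[ℂ] ℂ where
  toFun v := wirt v f x
  map_add' v w := by simp only [wirt, smul_add, map_add]; ring
  map_smul' c v := by
    have hc : c • v = (c.re : ℝ) • v + (c.im : ℝ) • (Complex.I • v) := by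
      rw [← Complex.coe_smul, ← Complex.coe_smul, smul_smul, ← add_smul, Complex.re_add_im]
    have hc' : Complex.I • (c • v) = (c.re : ℝ) • (Complex.I • v) - (c.im : ℝ) • v := by
      rw [← Complex.coe_smul, ← Complex.coe_smul, smul_smul, smul_smul, ← sub_smul]
      congr 1
      apply Complex.ext <;> simp
    simp only [wirt, RingHom.id_apply, smul_eq_mul]
    rw [hc', hc]
    simp only [map_add, map_sub, map_smul, Complex.real_smul]
    have hcc : c = (c.re : ℂ) + c.im * Complex.I := (Complex.re_add_im c).symm
    linear_combination (-(1 / 2) * ((fderiv ℝ f x) v - Complex.I * (fderiv ℝ f x) (Complex.I • v)))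
      * hcc + ((c.im : ℂ) * (fderiv ℝ f x) (Complex.I • v) / 2) * Complex.I_sq

/-- The `(0,1)`-part of the real differential, as a conjugate-linear map of the direction. -/
def wirtBarLin (f : TVec n → ℂ) (x : TVec n) : TVec n →ₛₗ[starRingEnd ℂ] ℂ where
  toFun v := wirtBar v f x
  map_add' v w := by simp only [wirtBar, smul_add, map_add]; ring
  map_smul' c v := by
    have hc : c • v = (c.re : ℝ) • v + (c.im : ℝ) • (Complex.I • v) := by
      rw [← Complex.coe_smul, ← Complex.coe_smul, smul_smul, ← add_smul, Complex.re_add_im]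
    have hc' : Complex.I • (c • v) = (c.re : ℝ) • (Complex.I • v) - (c.im : ℝ) • v := by
      rw [← Complex.coe_smul, ← Complex.coe_smul, smul_smul, smul_smul, ← sub_smul]
      congr 1
      apply Complex.ext <;> simp
    have hcc : conj c = (c.re : ℂ) - c.im * Complex.I := by
      apply Complex.ext <;> simp
    simp only [wirtBar, smul_eq_mul]
    rw [hc', hc, hcc]
    simp only [map_add, map_sub, map_smul, Complex.real_smul]
    linear_combination ((c.im : ℂ) * (fderiv ℝ f x) (Complex.I • v) / 2) * Complex.I_sq

@[simp] lemma wirtLin_apply (v : TVec n) : wirtLin f x v = wirt v f x := rfl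

@[simp] lemma wirtBarLin_apply (v : TVec n) : wirtBarLin f x v = wirtBar v f x := rfl

lemma wirt_add_dir (v w : TVec n) : wirt (v + w) f x = wirt v f x + wirt w f x :=
  map_add (wirtLin f x) v w

lemma wirt_smul_dir (c : ℂ) (v : TVec n) : wirt (c • v) f x = c * wirt v f x :=
  map_smul (wirtLin f x) c v

lemma wirtBar_smul_dir (c : ℂ) (v : TVec n) : wirtBar (c • v) f x = conj c * wirtBar v f x :=
  map_smulₛₗ (wirtBarLin f x) c v

lemma vec_eq_sum (a : CVec n) : a = ∑ i, a i • (Pi.single i 1 : CVec n) := by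
  ext j; simp [Finset.sum_apply, Pi.single_apply]

lemma wirt_eq_sum_dz (a : CVec n) : wirt (a, 0) f x = ∑ i, a i * dz i f x := by
  have h : ((a, 0) : TVec n) = ∑ i, a i • ((Pi.single i 1, 0) : TVec n) := by
    ext j <;> simp [Prod.fst_sum, Prod.snd_sum, Finset.sum_apply, Pi.single_apply]
  rw [h, ← wirtLin_apply, map_sum]
  simp only [map_smul, smul_eq_mul, wirtLin_apply, dz]

lemma wirt_eq_sum_dEta (a : CVec n) : wirt (0, a) f x = ∑ i, a i * dEta i f x := by
  have h : ((0, a) : TVec n) = ∑ i, a i • ((0, Pi.single i 1) : TVec n) := by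
    ext j <;> simp [Prod.fst_sum, Prod.snd_sum, Finset.sum_apply, Pi.single_apply]
  rw [h, ← wirtLin_apply, map_sum]
  simp only [map_smul, smul_eq_mul, wirtLin_apply, dEta]

lemma wirtBar_eq_sum_dEtaBar (a : CVec n) :
    wirtBar (0, a) f x = ∑ i, conj (a i) * dEtaBar i f x := by
  have h : ((0, a) : TVec n) = ∑ i, a i • ((0, Pi.single i 1) : TVec n) := by
    ext j <;> simp [Prod.fst_sum, Prod.snd_sum, Finset.sum_apply, Pi.single_apply]
  rw [h, ← wirtBarLin_apply, map_sum]
  simp only [map_smulₛₗ, smul_eq_mul, wirtBarLin_apply, dEtaBar]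

lemma wirt_prod (a b : CVec n) : wirt (a, b) f x = wirt (a, 0) f x + wirt (0, b) f x := by
  rw [← wirt_add_dir]; simp

lemma wirt_congr (h : f =ᶠ[nhds x] g) : wirt v f x = wirt v g x := by
  simp only [wirt, h.fderiv_eq]

lemma wirtBar_congr (h : f =ᶠ[nhds x] g) : wirtBar v f x = wirtBar v g x := by
  simp only [wirtBar, h.fderiv_eq]

lemma wirt_eventuallyEq (h : f =ᶠ[nhds x] g) : wirt v f =ᶠ[nhds x] wirt v g := by
  filter_upwards [h.eventuallyEq_nhds] with y hy using wirt_congr hy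

lemma wirtBar_eventuallyEq (h : f =ᶠ[nhds x] g) : wirtBar v f =ᶠ[nhds x] wirtBar v g := by
  filter_upwards [h.eventuallyEq_nhds] with y hy using wirtBar_congr hy

lemma wirt_mul (hf : DifferentiableAt ℝ f x) (hg : DifferentiableAt ℝ g x) :
    wirt v (fun y => f y * g y) x = wirt v f x * g x + f x * wirt v g x := by
  simp only [wirt, fderiv_fun_mul hf hg]
  simp
  ring

lemma wirtBar_mul (hf : DifferentiableAt ℝ f x) (hg : DifferentiableAt ℝ g x) :
    wirtBar v (fun y => f y * g y) x = wirtBar v f x * g x + f x * wirtBar v g x := by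
  simp only [wirtBar, fderiv_fun_mul hf hg]
  simp
  ring

lemma wirt_const_mul (c : ℂ) (hf : DifferentiableAt ℝ f x) :
    wirt v (fun y => c * f y) x = c * wirt v f x := by
  simp only [wirt, fderiv_const_mul hf]
  simp
  ring

lemma wirtBar_const_mul (c : ℂ) (hf : DifferentiableAt ℝ f x) :
    wirtBar v (fun y => c * f y) x = c * wirtBar v f x := by
  simp only [wirtBar, fderiv_const_mul hf]
  simp
  ring

lemma wirt_add (hf : DifferentiableAt ℝ f x) (hg : DifferentiableAt ℝ g x) :
    wirt v (fun y => f y + g y) x = wirt v f x + wirt v g x := by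
  simp only [wirt, fderiv_fun_add hf hg]
  simp
  ring

lemma wirtBar_add (hf : DifferentiableAt ℝ f x) (hg : DifferentiableAt ℝ g x) :
    wirtBar v (fun y => f y + g y) x = wirtBar v f x + wirtBar v g x := by
  simp only [wirtBar, fderiv_fun_add hf hg]
  simp
  ring

lemma wirt_sum {ι : Type*} {s : Finset ι} {f : ι → TVec n → ℂ}
    (hf : ∀ i ∈ s, DifferentiableAt ℝ (f i) x) :
    wirt v (fun y => ∑ i ∈ s, f i y) x = ∑ i ∈ s, wirt v (f i) x := by
  simp only [wirt, fderiv_fun_sum hf]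
  simp only [sum_apply, Finset.mul_sum, ← Finset.sum_sub_distrib]

lemma wirtBar_sum {ι : Type*} {s : Finset ι} {f : ι → TVec n → ℂ}
    (hf : ∀ i ∈ s, DifferentiableAt ℝ (f i) x) :
    wirtBar v (fun y => ∑ i ∈ s, f i y) x = ∑ i ∈ s, wirtBar v (f i) x := by
  simp only [wirtBar, fderiv_fun_sum hf]
  simp only [sum_apply, Finset.mul_sum, ← Finset.sum_add_distrib]

lemma fderiv_conj_comp (v : TVec n) :
    fderiv ℝ (fun y => conj (f y)) x v = conj (fderiv ℝ f x v) := by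
  have := Complex.conjCLE.comp_fderiv (f := f) (x := x)
  have h2 : (fun y => conj (f y)) = Complex.conjCLE ∘ f := by ext; simp
  rw [h2, this]
  simp

lemma wirt_conj : wirt v (fun y => conj (f y)) x = conj (wirtBar v f x) := by
  simp only [wirt, wirtBar, fderiv_conj_comp]
  simp [sub_eq_add_neg, map_ofNat]

lemma wirtBar_conj : wirtBar v (fun y => conj (f y)) x = conj (wirt v f x) := by
  simp only [wirt, wirtBar, fderiv_conj_comp]
  simp [sub_eq_add_neg, map_ofNat]

lemma wirt_of_holomorphic (hf : DifferentiableAt ℂ f x) : wirt v f x = fderiv ℂ f x v := by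
  simp only [wirt, hf.fderiv_restrictScalars ℝ, ContinuousLinearMap.coe_restrictScalars', map_smul,
    smul_eq_mul]
  linear_combination (-(fderiv ℂ f x v) / 2) * Complex.I_sq

lemma wirtBar_of_holomorphic (hf : DifferentiableAt ℂ f x) : wirtBar v f x = 0 := by
  simp only [wirtBar, hf.fderiv_restrictScalars ℝ, ContinuousLinearMap.coe_restrictScalars',
    map_smul, smul_eq_mul]
  linear_combination ((fderiv ℂ f x v) / 2) * Complex.I_sq

variable {Ψ : TVec n → TVec n}

lemma wirt_comp (hΨ : DifferentiableAt ℂ Ψ x) (hf : DifferentiableAt ℝ f (Ψ x)) :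
    wirt v (fun y => f (Ψ y)) x = wirt (fderiv ℂ Ψ x v) f (Ψ x) := by
  have := fderiv_comp x hf (hΨ.restrictScalars ℝ)
  simp only [wirt, Function.comp_def] at this ⊢
  rw [this, hΨ.fderiv_restrictScalars ℝ]
  simp

lemma wirtBar_comp (hΨ : DifferentiableAt ℂ Ψ x) (hf : DifferentiableAt ℝ f (Ψ x)) :
    wirtBar v (fun y => f (Ψ y)) x = wirtBar (fderiv ℂ Ψ x v) f (Ψ x) := by
  have := fderiv_comp x hf (hΨ.restrictScalars ℝ)
  simp only [wirtBar, Function.comp_def] at this ⊢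
  rw [this, hΨ.fderiv_restrictScalars ℝ]
  simp

lemma contDiffAt_wirt (hf : ContDiffAt ℝ ∞ f x) : ContDiffAt ℝ ∞ (wirt v f) x := by
  have h : ContDiffAt ℝ ∞ (fderiv ℝ f) x := hf.fderiv_right (by simp)
  unfold wirt
  exact contDiffAt_const.mul ((h.clm_apply contDiffAt_const).sub
    (contDiffAt_const.mul (h.clm_apply contDiffAt_const)))

lemma contDiffAt_wirtBar (hf : ContDiffAt ℝ ∞ f x) : ContDiffAt ℝ ∞ (wirtBar v f) x := by
  have h : ContDiffAt ℝ ∞ (fderiv ℝ f) x := hf.fderiv_right (by simp)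
  unfold wirtBar
  exact contDiffAt_const.mul ((h.clm_apply contDiffAt_const).add
    (contDiffAt_const.mul (h.clm_apply contDiffAt_const)))

lemma fderiv_fderiv_apply (hf : ContDiffAt ℝ ∞ f x) (u v : TVec n) :
    fderiv ℝ (fun y => fderiv ℝ f y u) x v = fderiv ℝ (fderiv ℝ f) x v u := by
  have h : DifferentiableAt ℝ (fderiv ℝ f) x :=
    (hf.fderiv_right (m := ∞) (by simp)).differentiableAt (by simp)
  rw [fderiv_clm_apply h (differentiableAt_const u)]
  simp

/-- Both sides expand into the real second derivative, whose symmetry gives the claim. -/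
lemma wirt_wirtBar_comm (hf : ContDiffAt ℝ ∞ f x) :
    wirt v (wirtBar w f) x = wirtBar w (wirt v f) x := by
  have h : DifferentiableAt ℝ (fderiv ℝ f) x :=
    (hf.fderiv_right (m := ∞) (by simp)).differentiableAt (by simp)
  have hd : ∀ u, DifferentiableAt ℝ (fun y => fderiv ℝ f y u) x := fun u =>
    h.clm_apply (differentiableAt_const u)
  have hs : IsSymmSndFDerivAt ℝ f x := hf.isSymmSndFDerivAt (by
    rw [minSmoothness_of_isRCLikeNormedField]; exact WithTop.coe_le_coe.2 (le_top (a := (2 : ℕ∞))))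
  have e1 : ∀ u, fderiv ℝ (wirtBar w f) x u = (1 / 2) * (fderiv ℝ (fderiv ℝ f) x u w
      + Complex.I * fderiv ℝ (fderiv ℝ f) x u (Complex.I • w)) := fun u => by
    unfold wirtBar
    rw [fderiv_const_mul (((hd w).fun_add ((hd (Complex.I • w)).const_mul Complex.I))),
      fderiv_fun_add (hd _) ((hd _).const_mul _), fderiv_const_mul (hd _)]
    simp [fderiv_fderiv_apply hf]
    ring
  have e2 : ∀ u, fderiv ℝ (wirt v f) x u = (1 / 2) * (fderiv ℝ (fderiv ℝ f) x u v
      - Complex.I * fderiv ℝ (fderiv ℝ f) x u (Complex.I • v)) := fun u => by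
    unfold wirt
    rw [fderiv_const_mul (((hd v).fun_sub ((hd (Complex.I • v)).const_mul Complex.I))),
      fderiv_fun_sub (hd _) ((hd _).const_mul _), fderiv_const_mul (hd _)]
    simp [fderiv_fderiv_apply hf]
  rw [wirt, wirtBar, e1, e1, e2, e2, hs v w, hs v (Complex.I • w), hs (Complex.I • v) w,
    hs (Complex.I • v) (Complex.I • w)]
  ring

/-- Differential along the complex line through `η` of a function homogeneous in `η`. -/
lemma fderiv_eta_of_homogeneous {h : ℂ → ℂ} {h' : ℂ →L[ℝ] ℂ} (hf : DifferentiableAt ℝ f x)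
    (hh : HasFDerivAt h h' 1) (hom : ∀ c : ℂ, c ≠ 0 → f (x.1, c • x.2) = h c * f x) (c : ℂ) :
    fderiv ℝ f x (0, c • x.2) = h' c * f x := by
  let l : ℂ → TVec n := fun c => (x.1, c • x.2)
  have hl : HasFDerivAt l ((0 : ℂ →L[ℝ] CVec n).prod
      ((ContinuousLinearMap.id ℝ ℂ).smulRight x.2)) 1 :=
    (hasFDerivAt_const x.1 (1 : ℂ)).prodMk ((hasFDerivAt_id (𝕜 := ℝ) (1 : ℂ)).smul_const x.2)
  have hl1 : l 1 = x := by simp [l]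
  have h1 : HasFDerivAt (f ∘ l) ((fderiv ℝ f x).comp _) 1 :=
    HasFDerivAt.comp (1 : ℂ) (by rw [hl1]; exact hf.hasFDerivAt) hl
  have h2 : HasFDerivAt (fun c => h c * f x) _ 1 := hh.mul_const (f x)
  have he : (fun c => h c * f x) =ᶠ[nhds 1] f ∘ l := by
    filter_upwards [isOpen_ne.mem_nhds (one_ne_zero (α := ℂ))] with c hc
    exact (hom c hc).symm
  have := (h2.congr_of_eventuallyEq he.symm).unique h1
  have := congrArg (fun T => T c) this
  simp only [ContinuousLinearMap.comp_apply] at this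
  simpa [mul_comm] using this.symm

/-- The two factors are `∂h/∂c` and `∂h/∂c̄` at `c = 1`, that is, the bidegree of `f` when `h c =
c^p c̄^q`. The derivative `h'` is only real-linear because `h` need not be holomorphic. -/
lemma euler_of_homogeneous {h : ℂ → ℂ} {h' : ℂ →L[ℝ] ℂ} (hf : DifferentiableAt ℝ f x)
    (hh : HasFDerivAt h h' 1) (hom : ∀ c : ℂ, c ≠ 0 → f (x.1, c • x.2) = h c * f x) :
    wirt (0, x.2) f x = (1 / 2) * (h' 1 - Complex.I * h' Complex.I) * f x ∧
    wirtBar (0, x.2) f x = (1 / 2) * (h' 1 + Complex.I * h' Complex.I) * f x := by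
  have e1 := fderiv_eta_of_homogeneous hf hh hom 1
  have e2 := fderiv_eta_of_homogeneous hf hh hom Complex.I
  rw [one_smul] at e1
  simp only [wirt, wirtBar, Prod.smul_mk, smul_zero, e1, e2]
  constructor <;> ring

/-- Euler's relation in degree `(1,0)`. -/
lemma euler_one (hf : DifferentiableAt ℝ f x)
    (hom : ∀ c : ℂ, c ≠ 0 → f (x.1, c • x.2) = c * f x) : wirt (0, x.2) f x = f x := by
  rw [(euler_of_homogeneous hf (hasFDerivAt_id (𝕜 := ℝ) (1 : ℂ)) hom).1]
  simp
  norm_num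

/-- Euler's relation in degree `(2,0)`. -/
lemma euler_two (hf : DifferentiableAt ℝ f x)
    (hom : ∀ c : ℂ, c ≠ 0 → f (x.1, c • x.2) = c ^ 2 * f x) : wirt (0, x.2) f x = 2 * f x := by
  rw [(euler_of_homogeneous hf ((hasFDerivAt_id (𝕜 := ℝ) (1 : ℂ)).pow 2) hom).1]
  simp only [smul_apply, ContinuousLinearMap.id_apply, smul_eq_mul, id_eq]
  linear_combination (-f x) * Complex.I_sq

/-- Euler's relation, conjugate part, in degree `(1,1)`. -/
lemma euler_bar (hf : DifferentiableAt ℝ f x)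
    (hom : ∀ c : ℂ, c ≠ 0 → f (x.1, c • x.2) = c * conj c * f x) :
    wirtBar (0, x.2) f x = f x := by
  have hc : HasFDerivAt (fun c : ℂ => conj c) (Complex.conjCLE : ℂ →L[ℝ] ℂ) 1 :=
    Complex.conjCLE.hasFDerivAt
  rw [(euler_of_homogeneous hf ((hasFDerivAt_id (𝕜 := ℝ) (1 : ℂ)).mul hc) hom).2]
  simp
  norm_num

end Wirtinger

/-! ### Fibre dilations, coordinate functions, smoothness of the inverse matrix -/

section Homogeneity

variable {D : Set (CVec n)} {F : TVec n → ℝ} {x : TVec n}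

lemma isOpen_slit (hD : IsOpen D) : IsOpen (slit D) :=
  (hD.preimage continuous_fst).inter (isOpen_ne.preimage continuous_snd)

lemma slit_mem_nhds (hD : IsOpen D) (hx : x ∈ slit D) : slit D ∈ nhds x :=
  (isOpen_slit hD).mem_nhds hx

lemma slit_mono {U : Set (CVec n)} (h : U ⊆ D) : slit U ⊆ slit D := fun _ hx => ⟨h hx.1, hx.2⟩

lemma smul_mem_slit {c : ℂ} (hc : c ≠ 0) (hx : x ∈ slit D) : (x.1, c • x.2) ∈ slit D :=
  ⟨hx.1, smul_ne_zero hc hx.2⟩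

/-- The energy `F²`, as a complex-valued function. -/
def energy (F : TVec n → ℝ) (y : TVec n) : ℂ := ((F y ^ 2 : ℝ) : ℂ)

lemma gMat_apply (F : TVec n → ℝ) (x : TVec n) (i j : Fin n) :
    gMat F x i j = dEta i (dEtaBar j (energy F)) x := rfl

lemma conj_energy (y : TVec n) : conj (energy F y) = energy F y := Complex.conj_ofReal _

lemma dEtaBar_energy_conj (k : Fin n) : dEtaBar k (energy F) x = conj (dEta k (energy F) x) := by
  have : energy F = fun y => conj (energy F y) := by ext y; rw [conj_energy]
  conv_lhs => rw [this]
  exact wirtBar_conj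

section Scaling

variable {f : TVec n → ℂ} {c k : ℂ}

/-- The dilation `(z, η) ↦ (z, c η)`. -/
def fiberScale (c : ℂ) : TVec n →L[ℂ] TVec n :=
  (ContinuousLinearMap.fst ℂ _ _).prod (c • ContinuousLinearMap.snd ℂ _ _)

/-- Chain rule for the complex-linear dilation. The scaling factor is an arbitrary constant `k`, so
that the rule can be iterated on derivatives of any bidegree. -/
lemma wirt_scale (hD : IsOpen D) (hx : x ∈ slit D) (hc : c ≠ 0)
    (hf : ∀ y ∈ slit D, DifferentiableAt ℝ f y)
    (hom : ∀ y ∈ slit D, f (y.1, c • y.2) = k * f y) (v : TVec n) :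
    wirt (v.1, c • v.2) f (x.1, c • x.2) = k * wirt v f x := by
  have h := wirt_comp (f := f) (x := x) (v := v) (fiberScale c).differentiableAt
    (hf _ (smul_mem_slit hc hx))
  rw [(fiberScale c).fderiv] at h
  refine Eq.trans h.symm ?_
  rw [← wirt_const_mul k (hf x hx)]
  refine wirt_congr ?_
  filter_upwards [slit_mem_nhds hD hx] with y hy using hom y hy

lemma wirtBar_scale (hD : IsOpen D) (hx : x ∈ slit D) (hc : c ≠ 0)
    (hf : ∀ y ∈ slit D, DifferentiableAt ℝ f y)
    (hom : ∀ y ∈ slit D, f (y.1, c • y.2) = k * f y) (v : TVec n) :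
    wirtBar (v.1, c • v.2) f (x.1, c • x.2) = k * wirtBar v f x := by
  have h := wirtBar_comp (f := f) (x := x) (v := v) (fiberScale c).differentiableAt
    (hf _ (smul_mem_slit hc hx))
  rw [(fiberScale c).fderiv] at h
  refine Eq.trans h.symm ?_
  rw [← wirtBar_const_mul k (hf x hx)]
  refine wirtBar_congr ?_
  filter_upwards [slit_mem_nhds hD hx] with y hy using hom y hy

lemma dz_scale (hD : IsOpen D) (hx : x ∈ slit D) (hc : c ≠ 0)
    (hf : ∀ y ∈ slit D, DifferentiableAt ℝ f y)
    (hom : ∀ y ∈ slit D, f (y.1, c • y.2) = k * f y) (j : Fin n) :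
    dz j f (x.1, c • x.2) = k * dz j f x := by
  simpa [dz] using wirt_scale hD hx hc hf hom (Pi.single j 1, 0)

lemma dEta_scale (hD : IsOpen D) (hx : x ∈ slit D) (hc : c ≠ 0)
    (hf : ∀ y ∈ slit D, DifferentiableAt ℝ f y)
    (hom : ∀ y ∈ slit D, f (y.1, c • y.2) = k * f y) (j : Fin n) :
    c * dEta j f (x.1, c • x.2) = k * dEta j f x := by
  rw [dEta, ← wirt_smul_dir]
  simpa using wirt_scale hD hx hc hf hom (0, Pi.single j 1)

lemma dEtaBar_scale (hD : IsOpen D) (hx : x ∈ slit D) (hc : c ≠ 0)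
    (hf : ∀ y ∈ slit D, DifferentiableAt ℝ f y)
    (hom : ∀ y ∈ slit D, f (y.1, c • y.2) = k * f y) (j : Fin n) :
    conj c * dEtaBar j f (x.1, c • x.2) = k * dEtaBar j f x := by
  rw [dEtaBar, ← wirtBar_smul_dir]
  simpa using wirtBar_scale hD hx hc hf hom (0, Pi.single j 1)

end Scaling

lemma contDiffAt_snd_apply (i : Fin n) : ContDiffAt ℝ ∞ (fun y : TVec n => y.2 i) x :=
  ((contDiff_apply ℝ ℂ i).comp contDiff_snd).contDiffAt

lemma contDiffAt_conj_comp {f : TVec n → ℂ} (hf : ContDiffAt ℝ ∞ f x) :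
    ContDiffAt ℝ ∞ (fun y => conj (f y)) x := by
  have := Complex.conjCLE.contDiff (n := ∞) |>.contDiffAt.comp x hf
  simpa [Function.comp_def] using this

lemma holomorphic_snd_apply (i : Fin n) : DifferentiableAt ℂ (fun y : TVec n => y.2 i) x :=
  (differentiableAt_pi.1 differentiableAt_snd) i

lemma wirt_snd_apply (v : TVec n) (i : Fin n) : wirt v (fun y : TVec n => y.2 i) x = v.2 i := by
  rw [wirt_of_holomorphic (holomorphic_snd_apply i)]
  have := ((ContinuousLinearMap.proj (R := ℂ) (φ := fun _ : Fin n => ℂ) i).comp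
    (ContinuousLinearMap.snd ℂ (CVec n) (CVec n))).fderiv (x := x)
  exact congrArg (fun T => T v) this

lemma wirtBar_snd_apply (v : TVec n) (i : Fin n) : wirtBar v (fun y : TVec n => y.2 i) x = 0 :=
  wirtBar_of_holomorphic (holomorphic_snd_apply i)

lemma wirt_conj_snd_apply (v : TVec n) (i : Fin n) :
    wirt v (fun y : TVec n => conj (y.2 i)) x = 0 := by
  rw [wirt_conj, wirtBar_snd_apply, map_zero]

lemma contDiffAt_det {A : TVec n → Matrix (Fin n) (Fin n) ℂ}
    (hA : ∀ i j, ContDiffAt ℝ ∞ (fun y => A y i j) x) :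
    ContDiffAt ℝ ∞ (fun y => (A y).det) x := by
  simp only [Matrix.det_apply, Units.smul_def, zsmul_eq_mul]
  exact ContDiffAt.sum fun σ _ => contDiffAt_const.mul (contDiffAt_prod fun i _ => hA _ _)

/-- Cramer's rule: entries of the inverse are determinants divided by `det A`. -/
lemma contDiffAt_matrix_inv {A : TVec n → Matrix (Fin n) (Fin n) ℂ}
    (hA : ∀ i j, ContDiffAt ℝ ∞ (fun y => A y i j) x) (hdet : (A x).det ≠ 0) (i j : Fin n) :
    ContDiffAt ℝ ∞ (fun y => (A y)⁻¹ i j) x := by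
  simp only [Matrix.inv_def, Matrix.smul_apply, smul_eq_mul, Ring.inverse_eq_inv',
    Matrix.adjugate_apply]
  refine ((contDiffAt_det hA).inv hdet).mul (contDiffAt_det fun a b => ?_)
  by_cases h : a = j
  · subst h; simpa using contDiffAt_const
  · simpa [Matrix.updateRow_ne h] using hA a b

end Homogeneity
-- Spray, torsion and `θ*` in terms of the energy
section Identities

variable {D : Set (CVec n)} {F : TVec n → ℝ} {x : TVec n}

/-- The covector `g_{i l̄} T^i_{jk} η^j η̄^l`, whose vanishing is the weak Kähler condition. -/
def kahlerForm (F : TVec n → ℝ) (k : Fin n) (x : TVec n) : ℂ :=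
  ∑ i, ∑ j, ∑ l, gMat F x i l * torsion F i j k x * x.2 j * conj (x.2 l)

lemma contDiffAt_ofReal_comp {f : TVec n → ℝ} (hf : ContDiffAt ℝ ∞ f x) :
    ContDiffAt ℝ ∞ (fun y => (f y : ℂ)) x :=
  Complex.ofRealCLM.contDiff.contDiffAt.comp x hf

lemma contDiffAt_metric (hD : IsOpen D) (hF : IsComplexFinslerMetric F D) (hx : x ∈ slit D) :
    ContDiffAt ℝ ∞ F x :=
  hF.smooth.contDiffAt (slit_mem_nhds hD hx)

lemma contDiffAt_energy (hD : IsOpen D) (hF : IsComplexFinslerMetric F D) (hx : x ∈ slit D) :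
    ContDiffAt ℝ ∞ (energy F) x :=
  contDiffAt_ofReal_comp ((contDiffAt_metric hD hF hx).pow 2)

lemma contDiffAt_gMat (hD : IsOpen D) (hF : IsComplexFinslerMetric F D) (hx : x ∈ slit D)
    (i j : Fin n) : ContDiffAt ℝ ∞ (fun y => gMat F y i j) x :=
  contDiffAt_wirt (contDiffAt_wirtBar (contDiffAt_energy hD hF hx))

lemma isUnit_gMat (hF : IsComplexFinslerMetric F D) (hx : x ∈ slit D) :
    IsUnit (gMat F x).det :=
  (Matrix.isUnit_iff_isUnit_det _).1 (hF.posDef x hx).isUnit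

lemma contDiffAt_gMat_inv (hD : IsOpen D) (hF : IsComplexFinslerMetric F D) (hx : x ∈ slit D)
    (i j : Fin n) : ContDiffAt ℝ ∞ (fun y => (gMat F y)⁻¹ i j) x :=
  contDiffAt_matrix_inv (fun i j => contDiffAt_gMat hD hF hx i j) (isUnit_gMat hF hx).ne_zero i j

lemma contDiffAt_chernN (hD : IsOpen D) (hF : IsComplexFinslerMetric F D) (hx : x ∈ slit D)
    (i j : Fin n) : ContDiffAt ℝ ∞ (chernN F i j) x :=
  ContDiffAt.sum fun m _ => ContDiffAt.sum fun l _ =>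
    ((contDiffAt_gMat_inv hD hF hx m i).mul (contDiffAt_wirt (contDiffAt_gMat hD hF hx l m))).mul
      (contDiffAt_snd_apply l)

lemma contDiffAt_spray (hD : IsOpen D) (hF : IsComplexFinslerMetric F D) (hx : x ∈ slit D)
    (i : Fin n) : ContDiffAt ℝ ∞ (spray F i) x :=
  contDiffAt_const.mul (ContDiffAt.sum fun j _ =>
    (contDiffAt_chernN hD hF hx i j).mul (contDiffAt_snd_apply j))

lemma diff_of_smooth {f : TVec n → ℂ} (hf : ContDiffAt ℝ ∞ f x) : DifferentiableAt ℝ f x :=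
  hf.differentiableAt (by simp)

lemma energy_smul (hF : IsComplexFinslerMetric F D) (hx : x ∈ slit D) (c : ℂ) :
    energy F (x.1, c • x.2) = c * conj c * energy F x := by
  rw [energy, energy, hF.homogeneous x.1 hx.1, Complex.mul_conj, Complex.normSq_eq_norm_sq]
  push_cast
  ring

lemma energy_ne_zero (hF : IsComplexFinslerMetric F D) (hx : x ∈ slit D) : energy F x ≠ 0 := by
  have : F x ≠ 0 := fun h => hx.2 ((hF.eq_zero_iff x.1 hx.1 x.2).1 h)
  simpa [energy] using this

lemma dEtaBar_energy_smul (hD : IsOpen D) (hF : IsComplexFinslerMetric F D) (hx : x ∈ slit D)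
    {c : ℂ} (hc : c ≠ 0) (m : Fin n) :
    dEtaBar m (energy F) (x.1, c • x.2) = c * dEtaBar m (energy F) x := by
  have h := dEtaBar_scale hD hx hc (fun y hy => diff_of_smooth (contDiffAt_energy hD hF hy))
    (fun y hy => energy_smul hF hy c) m
  have hc' : conj c ≠ 0 := by simpa using hc
  apply mul_left_cancel₀ hc'
  rw [h]; ring

lemma dEta_energy_smul (hD : IsOpen D) (hF : IsComplexFinslerMetric F D) (hx : x ∈ slit D)
    {c : ℂ} (hc : c ≠ 0) (m : Fin n) :
    dEta m (energy F) (x.1, c • x.2) = conj c * dEta m (energy F) x := by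
  have h := dEta_scale hD hx hc (fun y hy => diff_of_smooth (contDiffAt_energy hD hF hy))
    (fun y hy => energy_smul hF hy c) m
  apply mul_left_cancel₀ hc
  rw [h]; ring

lemma contDiffAt_dEtaBar_energy (hD : IsOpen D) (hF : IsComplexFinslerMetric F D)
    (hx : x ∈ slit D) (m : Fin n) : ContDiffAt ℝ ∞ (dEtaBar m (energy F)) x :=
  contDiffAt_wirtBar (contDiffAt_energy hD hF hx)

lemma gMat_smul (hD : IsOpen D) (hF : IsComplexFinslerMetric F D) (hx : x ∈ slit D)
    {c : ℂ} (hc : c ≠ 0) : gMat F (x.1, c • x.2) = gMat F x := by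
  ext i m
  have h := dEta_scale hD hx hc (fun y hy => diff_of_smooth (contDiffAt_dEtaBar_energy hD hF hy m))
    (fun y hy => dEtaBar_energy_smul hD hF hy hc m) i
  exact mul_left_cancel₀ hc h

lemma chernN_smul (hD : IsOpen D) (hF : IsComplexFinslerMetric F D) (hx : x ∈ slit D)
    {c : ℂ} (hc : c ≠ 0) (i j : Fin n) :
    chernN F i j (x.1, c • x.2) = c * chernN F i j x := by
  have h : ∀ l m, dz j (fun y => gMat F y l m) (x.1, c • x.2) = dz j (fun y => gMat F y l m) x :=
    fun l m => by
      simpa using dz_scale (k := 1) hD hx hc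
        (fun y hy => diff_of_smooth (contDiffAt_gMat hD hF hy l m))
        (fun y hy => by simp [gMat_smul hD hF hy hc]) j
  simp only [chernN, h, gMat_smul hD hF hx hc, Pi.smul_apply, smul_eq_mul, Finset.mul_sum]
  exact Finset.sum_congr rfl fun _ _ => Finset.sum_congr rfl fun _ _ => by ring

lemma spray_smul (hD : IsOpen D) (hF : IsComplexFinslerMetric F D) (hx : x ∈ slit D)
    {c : ℂ} (hc : c ≠ 0) (i : Fin n) : spray F i (x.1, c • x.2) = c ^ 2 * spray F i x := by
  simp only [spray, chernN_smul hD hF hx hc, Pi.smul_apply, smul_eq_mul, Finset.mul_sum]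
  exact Finset.sum_congr rfl fun _ _ => by ring

/-- Euler's relation for `∂F²/∂η̄^m`, which has bidegree `(1,0)`. -/
lemma sum_gMat_mul_snd (hD : IsOpen D) (hF : IsComplexFinslerMetric F D) (hx : x ∈ slit D)
    (m : Fin n) : ∑ l, gMat F x l m * x.2 l = dEtaBar m (energy F) x := by
  have h := euler_one (diff_of_smooth (contDiffAt_dEtaBar_energy hD hF hx m))
    (fun c hc => dEtaBar_energy_smul hD hF hx hc m)
  rw [wirt_eq_sum_dEta] at h
  rw [← h]
  exact Finset.sum_congr rfl fun _ _ => mul_comm _ _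

lemma sum_conj_mul_dEtaBar_energy (hD : IsOpen D) (hF : IsComplexFinslerMetric F D)
    (hx : x ∈ slit D) : ∑ l, conj (x.2 l) * dEtaBar l (energy F) x = energy F x := by
  have h := euler_bar (diff_of_smooth (contDiffAt_energy hD hF hx))
    (fun c _ => energy_smul hF hx c)
  rwa [wirtBar_eq_sum_dEtaBar] at h

/-- Differentiate `F² = η̄^l ∂F²/∂η̄^l`: the factor `η̄^l` is constant for derivatives of type
`(1,0)`. -/
lemma wirt_energy (hD : IsOpen D) (hF : IsComplexFinslerMetric F D) (hx : x ∈ slit D)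
    (v : TVec n) : wirt v (energy F) x
      = ∑ l, conj (x.2 l) * wirt v (dEtaBar l (energy F)) x := by
  have h : energy F =ᶠ[nhds x] fun y => ∑ l, conj (y.2 l) * dEtaBar l (energy F) y := by
    filter_upwards [slit_mem_nhds hD hx] with y hy
    exact (sum_conj_mul_dEtaBar_energy hD hF hy).symm
  have hd : ∀ l, DifferentiableAt ℝ (fun y : TVec n => conj (y.2 l)) x := fun l =>
    diff_of_smooth (contDiffAt_conj_comp (contDiffAt_snd_apply l))
  have hL : ∀ l, DifferentiableAt ℝ (dEtaBar l (energy F)) x := fun l =>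
    diff_of_smooth (contDiffAt_dEtaBar_energy hD hF hx l)
  rw [wirt_congr h, wirt_sum fun l _ => (hd l).fun_mul (hL l)]
  refine Finset.sum_congr rfl fun l _ => ?_
  rw [wirt_mul (hd l) (hL l), wirt_conj_snd_apply, zero_mul, zero_add]

lemma sum_gMat_mul_conj_snd (hD : IsOpen D) (hF : IsComplexFinslerMetric F D) (hx : x ∈ slit D)
    (i : Fin n) : ∑ l, gMat F x i l * conj (x.2 l) = dEta i (energy F) x := by
  rw [dEta, wirt_energy hD hF hx]
  exact Finset.sum_congr rfl fun _ _ => mul_comm _ _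

lemma sum_dz_gMat_mul_snd (hD : IsOpen D) (hF : IsComplexFinslerMetric F D) (hx : x ∈ slit D)
    (j m : Fin n) :
    ∑ l, dz j (fun y => gMat F y l m) x * x.2 l = dz j (dEtaBar m (energy F)) x := by
  have h : dEtaBar m (energy F) =ᶠ[nhds x] fun y => ∑ l, gMat F y l m * y.2 l := by
    filter_upwards [slit_mem_nhds hD hx] with y hy
    exact (sum_gMat_mul_snd hD hF hy m).symm
  have hd : ∀ l, DifferentiableAt ℝ (fun y : TVec n => y.2 l) x := fun l =>
    diff_of_smooth (contDiffAt_snd_apply l)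
  have hL : ∀ l, DifferentiableAt ℝ (fun y => gMat F y l m) x := fun l =>
    diff_of_smooth (contDiffAt_gMat hD hF hx l m)
  rw [dz, wirt_congr h, wirt_sum fun l _ => (hL l).fun_mul (hd l)]
  refine Finset.sum_congr rfl fun l _ => ?_
  rw [wirt_mul (hL l) (hd l), wirt_snd_apply]
  simp [dz]

/-- Lowering the index of `v^i = g^{m̄ i} c_m`. -/
lemma sum_gMat_mul_inv (hF : IsComplexFinslerMetric F D) (hx : x ∈ slit D)
    (c : Fin n → ℂ) (m : Fin n) :
    ∑ i, gMat F x i m * ∑ p, (gMat F x)⁻¹ p i * c p = c m := by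
  have h := Matrix.nonsing_inv_mul _ (isUnit_gMat hF hx)
  have h2 : ∀ p, ∑ i, (gMat F x)⁻¹ p i * gMat F x i m = if p = m then 1 else 0 := fun p => by
    have := congrFun (congrFun h p) m
    rwa [Matrix.mul_apply, Matrix.one_apply] at this
  calc ∑ i, gMat F x i m * ∑ p, (gMat F x)⁻¹ p i * c p
      = ∑ p, (∑ i, (gMat F x)⁻¹ p i * gMat F x i m) * c p := by
        simp only [Finset.mul_sum, Finset.sum_mul]
        rw [Finset.sum_comm]
        exact Finset.sum_congr rfl fun _ _ => Finset.sum_congr rfl fun _ _ => by ring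
    _ = c m := by simp [h2]

lemma eq_zero_of_gMat (hF : IsComplexFinslerMetric F D) (hx : x ∈ slit D) {a : Fin n → ℂ}
    (h : ∀ m, ∑ i, gMat F x i m * a i = 0) : a = 0 := by
  refine Matrix.eq_zero_of_vecMul_eq_zero (isUnit_gMat hF hx).ne_zero (M := gMat F x) ?_
  ext m
  simp only [Matrix.vecMul, dotProduct, Pi.zero_apply, ← h m]
  exact Finset.sum_congr rfl fun _ _ => mul_comm _ _

/-- Lowering the index removes the inverse matrix, and `η^l` passes through `∂/∂z^j`, so only a
second derivative of `F²` is left. -/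
lemma sum_gMat_mul_chernN (hD : IsOpen D) (hF : IsComplexFinslerMetric F D) (hx : x ∈ slit D)
    (j m : Fin n) : ∑ i, gMat F x i m * chernN F i j x = dz j (dEtaBar m (energy F)) x := by
  rw [← sum_gMat_mul_inv hF hx (fun m => dz j (dEtaBar m (energy F)) x) m]
  refine Finset.sum_congr rfl fun i _ => ?_
  congr 1
  refine Finset.sum_congr rfl fun p _ => ?_
  rw [← sum_dz_gMat_mul_snd hD hF hx, Finset.mul_sum]
  exact Finset.sum_congr rfl fun _ _ => by ring

lemma sum_gMat_mul_spray (hD : IsOpen D) (hF : IsComplexFinslerMetric F D) (hx : x ∈ slit D)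
    (m : Fin n) :
    2 * ∑ i, gMat F x i m * spray F i x = wirt (x.2, 0) (dEtaBar m (energy F)) x := by
  rw [wirt_eq_sum_dz]
  simp only [← sum_gMat_mul_chernN hD hF hx, spray, Finset.mul_sum]
  rw [Finset.sum_comm]
  exact Finset.sum_congr rfl fun _ _ => Finset.sum_congr rfl fun _ _ => by ring

lemma sum_dEta_energy_mul_chernN (hD : IsOpen D) (hF : IsComplexFinslerMetric F D)
    (hx : x ∈ slit D) (k : Fin n) :
    ∑ i, dEta i (energy F) x * chernN F i k x = dz k (energy F) x := by
  rw [dz, wirt_energy hD hF hx]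
  have : ∀ l, wirt (Pi.single k 1, 0) (dEtaBar l (energy F)) x
      = ∑ i, gMat F x i l * chernN F i k x := fun l => (sum_gMat_mul_chernN hD hF hx k l).symm
  simp only [this, ← sum_gMat_mul_conj_snd hD hF hx, Finset.mul_sum, Finset.sum_mul]
  rw [Finset.sum_comm]
  exact Finset.sum_congr rfl fun _ _ => Finset.sum_congr rfl fun _ _ => by ring

lemma sum_dEta_chernN_mul_snd (hD : IsOpen D) (hF : IsComplexFinslerMetric F D)
    (hx : x ∈ slit D) (i k : Fin n) :
    ∑ j, dEta j (chernN F i k) x * x.2 j = chernN F i k x := by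
  have h := euler_one (diff_of_smooth (contDiffAt_chernN hD hF hx i k))
    (fun c hc => chernN_smul hD hF hx hc i k)
  rw [wirt_eq_sum_dEta] at h
  conv_rhs => rw [← h]
  exact Finset.sum_congr rfl fun _ _ => mul_comm _ _

lemma sum_dEta_spray_mul_snd (hD : IsOpen D) (hF : IsComplexFinslerMetric F D)
    (hx : x ∈ slit D) (i : Fin n) : ∑ j, dEta j (spray F i) x * x.2 j = 2 * spray F i x := by
  have h := euler_two (diff_of_smooth (contDiffAt_spray hD hF hx i))
    (fun c hc => spray_smul hD hF hx hc i)
  rw [wirt_eq_sum_dEta] at h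
  conv_rhs => rw [← h]
  exact Finset.sum_congr rfl fun _ _ => mul_comm _ _

lemma two_mul_dEta_spray (hD : IsOpen D) (hF : IsComplexFinslerMetric F D)
    (hx : x ∈ slit D) (i k : Fin n) :
    2 * dEta k (spray F i) x = ∑ j, dEta k (chernN F i j) x * x.2 j + chernN F i k x := by
  have hd : ∀ l, DifferentiableAt ℝ (fun y : TVec n => y.2 l) x := fun l =>
    diff_of_smooth (contDiffAt_snd_apply l)
  have hN : ∀ j, DifferentiableAt ℝ (chernN F i j) x := fun j =>
    diff_of_smooth (contDiffAt_chernN hD hF hx i j)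
  have h : spray F i = fun y => (1 / 2) * ∑ j, chernN F i j y * y.2 j := rfl
  rw [h, dEta, wirt_const_mul _ (DifferentiableAt.fun_sum fun j _ => (hN j).fun_mul (hd j)),
    wirt_sum fun j _ => (hN j).fun_mul (hd j)]
  have : ∀ j, wirt (0, Pi.single k 1) (fun y => chernN F i j y * y.2 j) x
      = dEta k (chernN F i j) x * x.2 j + chernN F i j x * (Pi.single k 1 : CVec n) j := fun j => by
    rw [wirt_mul (hN j) (hd j), wirt_snd_apply]; rfl
  simp only [this, Finset.sum_add_distrib]
  simp [Pi.single_apply]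

/-- Euler's relation evaluates one term of the torsion; the other comes from differentiating `2G^i =
N^i_j η^j`. -/
lemma sum_torsion_mul_snd (hD : IsOpen D) (hF : IsComplexFinslerMetric F D)
    (hx : x ∈ slit D) (i k : Fin n) :
    ∑ j, torsion F i j k x * x.2 j = 2 * chernN F i k x - 2 * dEta k (spray F i) x := by
  simp only [torsion, chernL, sub_mul, Finset.sum_sub_distrib]
  rw [two_mul_dEta_spray hD hF hx, sum_dEta_chernN_mul_snd hD hF hx]
  ring

/-- Eliminates the connection coefficients: with `F²` and the spray alone, both the scaling and the
change of chart become computable. -/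
lemma kahlerForm_eq (hD : IsOpen D) (hF : IsComplexFinslerMetric F D) (hx : x ∈ slit D)
    (k : Fin n) : kahlerForm F k x
      = 2 * (dz k (energy F) x - ∑ i, dEta i (energy F) x * dEta k (spray F i) x) := by
  have h : kahlerForm F k x
      = ∑ i, dEta i (energy F) x * ∑ j, torsion F i j k x * x.2 j := by
    unfold kahlerForm
    refine Finset.sum_congr rfl fun i _ => ?_
    rw [← sum_gMat_mul_conj_snd hD hF hx, Finset.sum_mul_sum, Finset.sum_comm]
    exact Finset.sum_congr rfl fun _ _ => Finset.sum_congr rfl fun _ _ => by ring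
  rw [h]
  simp only [sum_torsion_mul_snd hD hF hx, mul_sub, Finset.sum_sub_distrib,
    ← sum_dEta_energy_mul_chernN hD hF hx, Finset.mul_sum]
  congr 1 <;> exact Finset.sum_congr rfl fun _ _ => by ring

/-- Since `g` is Hermitian, the factor contracted with `g^{m̄ k}` is the conjugate of the Kähler
form. -/
lemma thetaStar_eq (hF : IsComplexFinslerMetric F D) (hx : x ∈ slit D) (k : Fin n) :
    thetaStar F k x = ∑ m, (gMat F x)⁻¹ m k * conj (kahlerForm F m x) := by
  have hg : ∀ p h, conj (gMat F x p h) = gMat F x h p := fun p h =>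
    (hF.posDef x hx).isHermitian.apply h p
  unfold thetaStar kahlerForm
  refine Finset.sum_congr rfl fun m _ => ?_
  simp only [map_sum, map_mul, hg, Complex.conj_conj, Finset.mul_sum]
  rw [Finset.sum_comm]
  refine Finset.sum_congr rfl fun p _ => ?_
  rw [Finset.sum_comm]
  exact Finset.sum_congr rfl fun _ _ => Finset.sum_congr rfl fun _ _ => by ring

lemma sum_gMat_mul_thetaStar (hF : IsComplexFinslerMetric F D) (hx : x ∈ slit D) (m : Fin n) :
    ∑ k, gMat F x k m * thetaStar F k x = conj (kahlerForm F m x) := by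
  simp only [thetaStar_eq hF hx]
  exact sum_gMat_mul_inv hF hx (fun m => conj (kahlerForm F m x)) m

lemma sum_dEta_energy_mul_spray (hD : IsOpen D) (hF : IsComplexFinslerMetric F D)
    (hx : x ∈ slit D) :
    2 * ∑ i, dEta i (energy F) x * spray F i x = wirt (x.2, 0) (energy F) x := by
  rw [wirt_eq_sum_dz]
  simp only [← sum_dEta_energy_mul_chernN hD hF hx, spray, Finset.mul_sum]
  rw [Finset.sum_comm]
  exact Finset.sum_congr rfl fun _ _ => Finset.sum_congr rfl fun _ _ => by ring

/-- The spray has degree two in `η`, so both terms of `kahlerForm_eq` contract with `η` to `η^k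
∂F²/∂z^k`. -/
lemma sum_kahlerForm_mul_snd (hD : IsOpen D) (hF : IsComplexFinslerMetric F D)
    (hx : x ∈ slit D) : ∑ k, kahlerForm F k x * x.2 k = 0 := by
  have h1 : ∑ k, dz k (energy F) x * x.2 k = wirt (x.2, 0) (energy F) x := by
    rw [wirt_eq_sum_dz]; exact Finset.sum_congr rfl fun _ _ => mul_comm _ _
  have h2 : ∑ k, (∑ i, dEta i (energy F) x * dEta k (spray F i) x) * x.2 k
      = wirt (x.2, 0) (energy F) x := by
    rw [← sum_dEta_energy_mul_spray hD hF hx, Finset.mul_sum]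
    simp only [Finset.sum_mul]
    rw [Finset.sum_comm]
    refine Finset.sum_congr rfl fun i _ => ?_
    rw [mul_left_comm, ← sum_dEta_spray_mul_snd hD hF hx, Finset.mul_sum]
    exact Finset.sum_congr rfl fun _ _ => by ring
  simp only [kahlerForm_eq hD hF hx, mul_assoc, ← Finset.mul_sum, sub_mul,
    Finset.sum_sub_distrib, h1]
  rw [h2, sub_self, mul_zero]

lemma kahlerForm_smul (hD : IsOpen D) (hF : IsComplexFinslerMetric F D) (hx : x ∈ slit D)
    {c : ℂ} (hc : c ≠ 0) (k : Fin n) :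
    kahlerForm F k (x.1, c • x.2) = c * conj c * kahlerForm F k x := by
  have h1 := dz_scale hD hx hc (fun y hy => diff_of_smooth (contDiffAt_energy hD hF hy))
    (fun y hy => energy_smul hF hy c) k
  have h2 : ∀ i, dEta k (spray F i) (x.1, c • x.2) = c * dEta k (spray F i) x := fun i => by
    have := dEta_scale hD hx hc (fun y hy => diff_of_smooth (contDiffAt_spray hD hF hy i))
      (fun y hy => spray_smul hD hF hy hc i) k
    apply mul_left_cancel₀ hc
    rw [this]; ring
  rw [kahlerForm_eq hD hF hx, kahlerForm_eq hD hF (smul_mem_slit hc hx), h1]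
  simp only [h2, dEta_energy_smul hD hF hx hc]
  have : ∀ i, conj c * dEta i (energy F) x * (c * dEta k (spray F i) x)
      = c * conj c * (dEta i (energy F) x * dEta k (spray F i) x) := fun i => by ring
  simp only [this, ← Finset.mul_sum]
  ring

/-- Bidegree `(1,1)`, against `(2,0)` for the spray: this mismatch is what later forces `θ*` to
vanish. -/
lemma thetaStar_smul (hD : IsOpen D) (hF : IsComplexFinslerMetric F D) (hx : x ∈ slit D)
    {c : ℂ} (hc : c ≠ 0) (k : Fin n) :
    thetaStar F k (x.1, c • x.2) = c * conj c * thetaStar F k x := by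
  rw [thetaStar_eq hF hx, thetaStar_eq hF (smul_mem_slit hc hx), Finset.mul_sum]
  refine Finset.sum_congr rfl fun m _ => ?_
  rw [gMat_smul hD hF hx hc, kahlerForm_smul hD hF hx hc]
  simp only [map_mul, Complex.conj_conj]
  ring

lemma sum_dEta_energy_mul_thetaStar (hD : IsOpen D) (hF : IsComplexFinslerMetric F D)
    (hx : x ∈ slit D) : ∑ i, dEta i (energy F) x * thetaStar F i x = 0 := by
  have h := congrArg conj (sum_kahlerForm_mul_snd hD hF hx)
  simp only [map_sum, map_mul, ← sum_gMat_mul_thetaStar hF hx, map_zero] at h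
  rw [← h]
  simp only [← sum_gMat_mul_conj_snd hD hF hx, Finset.sum_mul]
  rw [Finset.sum_comm]
  exact Finset.sum_congr rfl fun _ _ => Finset.sum_congr rfl fun _ _ => by ring

lemma thetaStar_eq_zero_iff (hF : IsComplexFinslerMetric F D) (hx : x ∈ slit D) :
    (∀ k, thetaStar F k x = 0) ↔ ∀ k, kahlerForm F k x = 0 := by
  constructor
  · intro h k
    have := sum_gMat_mul_thetaStar hF hx k
    simpa [h] using this.symm
  · intro h k
    simp [thetaStar_eq hF hx, h]

lemma sum_dEta_energy_mul_snd (hD : IsOpen D) (hF : IsComplexFinslerMetric F D)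
    (hx : x ∈ slit D) : ∑ i, dEta i (energy F) x * x.2 i = energy F x := by
  have h := congrArg conj (sum_conj_mul_dEtaBar_energy hD hF hx)
  simpa [dEtaBar_energy_conj, conj_energy, mul_comm] using h

end Identities
-- Projective flatness in fixed coordinates
section FlatInCoordinates

variable {D : Set (CVec n)} {F F' : TVec n → ℝ} {x : TVec n}

lemma wirt_horizontal_eq_zero {f : TVec n → ℂ} (hD : IsOpen D) (hx : x.1 ∈ D)
    (hf : DifferentiableAt ℝ f x) (hc : ∀ z ∈ D, f (z, x.2) = f x) (a : CVec n) :
    wirt (a, 0) f x = 0 := by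
  have h1 : HasFDerivAt (fun z : CVec n => f (z, x.2))
      ((fderiv ℝ f x).comp ((ContinuousLinearMap.id ℝ (CVec n)).prod 0)) x.1 :=
    HasFDerivAt.comp (g := f) x.1 hf.hasFDerivAt
      ((hasFDerivAt_id (𝕜 := ℝ) x.1).prodMk (hasFDerivAt_const x.2 x.1))
  have h2 : HasFDerivAt (fun z : CVec n => f (z, x.2)) (0 : CVec n →L[ℝ] ℂ) x.1 := by
    refine (hasFDerivAt_const (f x) x.1).congr_of_eventuallyEq ?_
    filter_upwards [hD.mem_nhds hx] with z hz using hc z hz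
  have h3 : ∀ b : CVec n, fderiv ℝ f x (b, 0) = 0 := fun b => by
    simpa using congrArg (fun T => T b) (h1.unique h2)
  simp [wirt, h3]

lemma chernN_eq_zero_of_minkowski (hD : IsOpen D) (hF : IsComplexFinslerMetric F D)
    (hM : IsMinkowskiInCoords F D) (hx : x ∈ slit D) (i j : Fin n) : chernN F i j x = 0 := by
  refine Finset.sum_eq_zero fun m _ => Finset.sum_eq_zero fun l _ => ?_
  have : dz j (fun y => gMat F y l m) x = 0 :=
    wirt_horizontal_eq_zero hD hx.1 (diff_of_smooth (contDiffAt_gMat hD hF hx l m))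
      (fun z hz => by rw [hM z hz x.1 hx.1 x.2 hx.2]) _
  rw [this, mul_zero, zero_mul]

lemma spray_eq_zero_of_minkowski (hD : IsOpen D) (hF : IsComplexFinslerMetric F D)
    (hM : IsMinkowskiInCoords F D) (hx : x ∈ slit D) (i : Fin n) : spray F i x = 0 := by
  simp [spray, chernN_eq_zero_of_minkowski hD hF hM hx]

lemma thetaStar_eq_zero_of_minkowski (hD : IsOpen D) (hF : IsComplexFinslerMetric F D)
    (hM : IsMinkowskiInCoords F D) (hx : x ∈ slit D) (k : Fin n) : thetaStar F k x = 0 := by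
  have h : ∀ i j k, dEta j (chernN F i k) x = 0 := fun i j k => by
    have h0 : chernN F i k =ᶠ[nhds x] fun _ => 0 := by
      filter_upwards [slit_mem_nhds hD hx] with y hy
      exact chernN_eq_zero_of_minkowski hD hF hM hy i k
    rw [dEta, wirt_congr h0]
    simp [wirt]
  simp [thetaStar, torsion, chernL, h]

lemma dz_energy (hD : IsOpen D) (hF : IsComplexFinslerMetric F D) (hx : x ∈ slit D) (k : Fin n) :
    dz k (energy F) x = 2 * F x * dz k (fun y => (F y : ℂ)) x := by
  have hd := diff_of_smooth (contDiffAt_ofReal_comp (contDiffAt_metric hD hF hx))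
  have h : energy F = fun y => (F y : ℂ) * (F y : ℂ) := by
    ext y; simp [energy, sq]
  rw [dz, h, wirt_mul hd hd, dz]
  ring

lemma metric_ne_zero (hF : IsComplexFinslerMetric F D) (hx : x ∈ slit D) : F x ≠ 0 :=
  fun h => hx.2 ((hF.eq_zero_iff x.1 hx.1 x.2).1 h)

/-- The factor `(1/F) (∂F/∂z^k) η^k`. -/
def sprayFactor (F : TVec n → ℝ) (x : TVec n) : ℂ :=
  1 / (F x : ℂ) * ∑ k, dz k (fun y => (F y : ℂ)) x * x.2 k

lemma contDiffAt_sprayFactor (hD : IsOpen D) (hF : IsComplexFinslerMetric F D)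
    (hx : x ∈ slit D) : ContDiffAt ℝ ∞ (sprayFactor F) x := by
  have h := contDiffAt_ofReal_comp (contDiffAt_metric hD hF hx)
  have h0 : (F x : ℂ) ≠ 0 := by exact_mod_cast metric_ne_zero hF hx
  unfold sprayFactor
  simp only [one_div]
  exact (h.inv h0).mul (ContDiffAt.sum fun k _ =>
    (contDiffAt_wirt h).mul (contDiffAt_snd_apply k))

/-- From `∂F²/∂z^k = 2F ∂F/∂z^k`. It is the denominator-free form in which the factor is scaled and
differentiated. -/
lemma two_mul_sprayFactor_mul_energy (hD : IsOpen D) (hF : IsComplexFinslerMetric F D)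
    (hx : x ∈ slit D) :
    2 * (sprayFactor F x * energy F x) = wirt (x.2, 0) (energy F) x := by
  have h0 : (F x : ℂ) ≠ 0 := by exact_mod_cast metric_ne_zero hF hx
  have h1 : energy F x = F x * F x := by simp [energy, sq]
  rw [wirt_eq_sum_dz]
  simp only [dz_energy hD hF hx]
  rw [h1, sprayFactor]
  field_simp
  simp only [Finset.mul_sum]
  exact Finset.sum_congr rfl fun _ _ => by ring

lemma sprayFactor_smul (hD : IsOpen D) (hF : IsComplexFinslerMetric F D) (hx : x ∈ slit D)
    {c : ℂ} (hc : c ≠ 0) : sprayFactor F (x.1, c • x.2) = c * sprayFactor F x := by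
  have hcx := smul_mem_slit hc hx
  have h1 := two_mul_sprayFactor_mul_energy hD hF hx
  have h2 := two_mul_sprayFactor_mul_energy hD hF hcx
  have h3 : wirt (c • x.2, 0) (energy F) (x.1, c • x.2)
      = c * (c * conj c) * wirt (x.2, 0) (energy F) x := by
    have := wirt_scale hD hx hc (fun y hy => diff_of_smooth (contDiffAt_energy hD hF hy))
      (fun y hy => energy_smul hF hy c) (c • x.2, 0)
    simp only [smul_zero] at this
    rw [this, show ((c • x.2, 0) : TVec n) = c • (x.2, 0) by simp, wirt_smul_dir]
    ring
  have hE := energy_ne_zero hF hcx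
  have h4 := energy_smul hF hx c
  apply mul_right_cancel₀ hE
  linear_combination (1 / 2) * h2 + (1 / 2) * h3 - (c * (c * conj c) / 2) * h1
    - c * sprayFactor F x * h4

/-- When the spray is a multiple of the radial vector, it is holomorphic in `η`. -/
lemma dEtaBar_sprayFactor (hD : IsOpen D) (hF : IsComplexFinslerMetric F D)
    (hS : ∀ y ∈ slit D, ∀ i, spray F i y = sprayFactor F y * y.2 i) (hx : x ∈ slit D)
    (l : Fin n) : dEtaBar l (sprayFactor F) x = 0 := by
  have hE := contDiffAt_energy hD hF hx
  have hq := diff_of_smooth (contDiffAt_sprayFactor hD hF hx)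
  have hd : ∀ k, DifferentiableAt ℝ (fun y : TVec n => y.2 k) x := fun k =>
    diff_of_smooth (contDiffAt_snd_apply k)
  have hz : ∀ k, DifferentiableAt ℝ (dz k (energy F)) x := fun k =>
    diff_of_smooth (contDiffAt_wirt hE)
  have e1 : (fun y => 2 * (sprayFactor F y * energy F y))
      =ᶠ[nhds x] fun y => ∑ k, y.2 k * dz k (energy F) y := by
    filter_upwards [slit_mem_nhds hD hx] with y hy
    rw [two_mul_sprayFactor_mul_energy hD hF hy, wirt_eq_sum_dz]
  have e2 := wirtBar_congr (v := (0, Pi.single l 1)) e1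
  rw [wirtBar_const_mul _ (hq.fun_mul (diff_of_smooth hE)), wirtBar_mul hq (diff_of_smooth hE),
    wirtBar_sum fun k _ => (hd k).fun_mul (hz k)] at e2
  have e3 : ∀ k, wirtBar (0, Pi.single l 1) (fun y => y.2 k * dz k (energy F) y) x
      = x.2 k * dz k (dEtaBar l (energy F)) x := fun k => by
    rw [wirtBar_mul (hd k) (hz k), wirtBar_snd_apply, zero_mul, zero_add]
    congr 1
    exact (wirt_wirtBar_comm hE).symm
  simp only [e3, ← wirt_eq_sum_dz] at e2
  -- Lowering the hypothesis on the spray produces the same mixed derivative as the right side of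
  -- `e2`. The terms with `∂F²/∂η̄^l` cancel, and only `F² ∂q/∂η̄^l = 0` remains.
  have e4 : 2 * (sprayFactor F x * dEtaBar l (energy F) x)
      = wirt (x.2, 0) (dEtaBar l (energy F)) x := by
    rw [← sum_gMat_mul_spray hD hF hx, ← sum_gMat_mul_snd hD hF hx, Finset.mul_sum]
    congr 1
    exact Finset.sum_congr rfl fun i _ => by rw [hS x hx]; ring
  have e5 : dEtaBar l (sprayFactor F) x * energy F x = 0 := by
    rw [← e4] at e2
    simp only [dEtaBar] at e2 ⊢
    linear_combination (1 / 2) * e2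
  exact (mul_eq_zero.1 e5).resolve_right (energy_ne_zero hF hx)

lemma isGeneralizedBerwald_of_sprayFactor (hD : IsOpen D) (hF : IsComplexFinslerMetric F D)
    (hS : ∀ y ∈ slit D, ∀ i, spray F i y = sprayFactor F y * y.2 i) :
    IsGeneralizedBerwald F D := by
  intro x hx i h
  have e : spray F i =ᶠ[nhds x] fun y => sprayFactor F y * y.2 i := by
    filter_upwards [slit_mem_nhds hD hx] with y hy using hS y hy i
  rw [dEtaBar, wirtBar_congr e, wirtBar_mul (diff_of_smooth (contDiffAt_sprayFactor hD hF hx))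
    (diff_of_smooth (contDiffAt_snd_apply i)), wirtBar_snd_apply, mul_zero, add_zero]
  exact mul_eq_zero_of_left (dEtaBar_sprayFactor hD hF hS hx h) _

lemma berwald_and_sprayIdentity_of_flat (hD : IsOpen D) (hF : IsComplexFinslerMetric F D)
    (h : IsProjectivelyFlatInCoords F D) : IsComplexBerwald F D ∧ SprayIdentity F D := by
  obtain ⟨F', hF', hM, P, -, hP⟩ := h
  have key : ∀ x ∈ slit D, ∀ i, spray F i x - (1 / 2) * thetaStar F i x + P x * x.2 i = 0 := by
    intro x hx i
    have := hP x hx i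
    rw [spray_eq_zero_of_minkowski hD hF' hM hx, thetaStar_eq_zero_of_minkowski hD hF' hM hx]
      at this
    linear_combination -this
  -- Contraction with `∂F²/∂η^i` kills `θ*` and turns `η` into `F²`, which determines `P`.
  have hPval : ∀ x ∈ slit D, P x = -sprayFactor F x := by
    intro x hx
    have h1 : ∑ i, dEta i (energy F) x
        * (spray F i x - (1 / 2) * thetaStar F i x + P x * x.2 i) = 0 :=
      Finset.sum_eq_zero fun i _ => by rw [key x hx i, mul_zero]
    have h2 : ∑ i, dEta i (energy F) x
        * (spray F i x - (1 / 2) * thetaStar F i x + P x * x.2 i)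
        = ∑ i, dEta i (energy F) x * spray F i x
          - (1 / 2) * ∑ i, dEta i (energy F) x * thetaStar F i x
          + P x * ∑ i, dEta i (energy F) x * x.2 i := by
      simp only [Finset.mul_sum, ← Finset.sum_sub_distrib, ← Finset.sum_add_distrib]
      exact Finset.sum_congr rfl fun _ _ => by ring
    rw [h2, sum_dEta_energy_mul_thetaStar hD hF hx, sum_dEta_energy_mul_snd hD hF hx] at h1
    have h3 := sum_dEta_energy_mul_spray hD hF hx
    have h4 := two_mul_sprayFactor_mul_energy hD hF hx
    apply mul_right_cancel₀ (energy_ne_zero hF hx)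
    linear_combination h1 - (1 / 2) * h3 + (1 / 2) * h4
  -- Compare `key` at `η` and at `iη`: the spray and the radial term change sign, `θ*` does not. Any
  -- `c ≠ 0` with `c² ≠ |c|²` would serve.
  have hθ : ∀ x ∈ slit D, ∀ i, thetaStar F i x = 0 := by
    intro x hx i
    have hI : Complex.I ≠ 0 := Complex.I_ne_zero
    have h1 := key x hx i
    have h2 := key _ (smul_mem_slit hI hx) i
    rw [hPval x hx] at h1
    rw [hPval _ (smul_mem_slit hI hx), spray_smul hD hF hx hI, thetaStar_smul hD hF hx hI,
      sprayFactor_smul hD hF hx hI] at h2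
    simp only [Pi.smul_apply, smul_eq_mul, Complex.conj_I] at h2
    linear_combination -h1 - h2
      + (spray F i x - sprayFactor F x * x.2 i + (1 / 2) * thetaStar F i x) * Complex.I_sq
  have hS : ∀ y ∈ slit D, ∀ i, spray F i y = sprayFactor F y * y.2 i := by
    intro y hy i
    have h1 := key y hy i
    rw [hθ y hy, hPval y hy] at h1
    linear_combination h1
  exact ⟨⟨isGeneralizedBerwald_of_sprayFactor hD hF hS,
    fun x hx => (thetaStar_eq_zero_iff hF hx).1 (hθ x hx)⟩, hS⟩

end FlatInCoordinates

/-! ### The Euclidean metric as flat model -/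

section Euclidean

variable {D : Set (CVec n)} {F : TVec n → ℝ}

/-- The Euclidean metric `(∑ |η^i|²)^{1/2}`. -/
def euclid (y : TVec n) : ℝ := √(∑ i, ‖y.2 i‖ ^ 2)

lemma energy_euclid (y : TVec n) : energy euclid y = ∑ i, y.2 i * conj (y.2 i) := by
  rw [energy, euclid, Real.sq_sqrt (Finset.sum_nonneg fun i _ => sq_nonneg _)]
  simp [Complex.mul_conj, Complex.normSq_eq_norm_sq]

lemma gMat_euclid (x : TVec n) : gMat euclid x = 1 := by
  have h : ∀ j, dEtaBar j (energy (euclid (n := n))) = fun y => y.2 j := fun j => by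
    ext y
    have e : energy (euclid (n := n)) = fun y => ∑ i, y.2 i * conj (y.2 i) :=
      funext energy_euclid
    have h1 : ∀ i, DifferentiableAt ℝ (fun y : TVec n => y.2 i) y := fun i =>
      diff_of_smooth (contDiffAt_snd_apply i)
    have h2 : ∀ i, DifferentiableAt ℝ (fun y : TVec n => conj (y.2 i)) y := fun i =>
      diff_of_smooth (contDiffAt_conj_comp (contDiffAt_snd_apply i))
    rw [e, dEtaBar, wirtBar_sum fun i _ => (h1 i).fun_mul (h2 i)]
    have h3 : ∀ i, wirtBar (0, Pi.single j 1) (fun y : TVec n => y.2 i * conj (y.2 i)) y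
        = y.2 i * conj ((Pi.single j 1 : CVec n) i) := fun i => by
      rw [wirtBar_mul (h1 i) (h2 i), wirtBar_snd_apply, wirtBar_conj, wirt_snd_apply, zero_mul,
        zero_add]
    simp only [h3]
    simp [Pi.single_apply, apply_ite]
  ext i j
  rw [gMat_apply, h, dEta, wirt_snd_apply, Matrix.one_apply]
  simp [Pi.single_apply, eq_comm]

lemma isComplexFinslerMetric_euclid (D : Set (CVec n)) : IsComplexFinslerMetric euclid D where
  continuousOn := by unfold euclid; fun_prop
  smooth := by
    intro x hx
    refine ContDiffAt.contDiffWithinAt ?_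
    refine ContDiffAt.sqrt (ContDiffAt.sum fun i _ => ?_) ?_
    · exact (contDiff_norm_sq ℝ).contDiffAt.comp x (contDiffAt_snd_apply i)
    · intro h
      apply hx.2
      rw [Finset.sum_eq_zero_iff_of_nonneg fun _ _ => sq_nonneg _] at h
      ext i
      simpa using h i (Finset.mem_univ i)
  nonneg _ _ _ := Real.sqrt_nonneg _
  eq_zero_iff z _ η := by
    rw [euclid, Real.sqrt_eq_zero (Finset.sum_nonneg fun i _ => sq_nonneg _),
      Finset.sum_eq_zero_iff_of_nonneg fun _ _ => sq_nonneg _]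
    simp [funext_iff]
  homogeneous z _ c η := by
    simp only [euclid, Pi.smul_apply, norm_smul, mul_pow, ← Finset.mul_sum]
    rw [Real.sqrt_mul (sq_nonneg _), Real.sqrt_sq (norm_nonneg _)]
  posDef x _ := by rw [gMat_euclid]; exact Matrix.PosDef.one

lemma isMinkowskiInCoords_euclid (D : Set (CVec n)) : IsMinkowskiInCoords euclid D :=
  fun z _ z' _ η _ => by rw [gMat_euclid, gMat_euclid]

/-- All terms except `G = qη` vanish: the Euclidean ones by flatness, `θ*` of `F` by the weak Kähler
condition. Hence `P = -q`. -/
lemma projectivelyRelated_euclid (hD : IsOpen D) (hF : IsComplexFinslerMetric F D)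
    (hW : IsWeaklyKahler F D) (hS : SprayIdentity F D) : ProjectivelyRelated F euclid D := by
  refine ⟨fun x => -sprayFactor F x, fun x hx =>
    (contDiffAt_sprayFactor hD hF hx).neg.contDiffWithinAt, fun x hx i => ?_⟩
  have hE := isComplexFinslerMetric_euclid D
  have hM := isMinkowskiInCoords_euclid D
  have h : spray F i x = sprayFactor F x * x.2 i := hS x hx i
  rw [spray_eq_zero_of_minkowski hD hE hM hx, thetaStar_eq_zero_of_minkowski hD hE hM hx,
    (thetaStar_eq_zero_iff hF hx).2 (hW x hx), h]
  ring

lemma isProjectivelyFlatInCoords_iff (hD : IsOpen D) (hF : IsComplexFinslerMetric F D) :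
    IsProjectivelyFlatInCoords F D ↔ IsComplexBerwald F D ∧ SprayIdentity F D :=
  ⟨berwald_and_sprayIdentity_of_flat hD hF, fun h =>
    ⟨euclid, isComplexFinslerMetric_euclid D, isMinkowskiInCoords_euclid D,
      projectivelyRelated_euclid hD hF h.1.2 h.2⟩⟩

end Euclidean
-- Holomorphic charts and the transformation law of the spray
section Charts

variable {φ : OpenPartialHomeomorph (CVec n) (CVec n)} {D : Set (CVec n)} {F F' : TVec n → ℝ}
  {x : TVec n}

/-- The map induced on the holomorphic tangent bundle by the inverse of `φ`. -/
def tangentLift (φ : OpenPartialHomeomorph (CVec n) (CVec n)) (x : TVec n) : TVec n :=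
  (φ.symm x.1, fderiv ℂ φ.symm x.1 x.2)

lemma inChart_apply (x : TVec n) : inChart φ F x = F (tangentLift φ x) := rfl

/-- `φ` is biholomorphic from its source to its target. -/
structure IsBiholomorphic (φ : OpenPartialHomeomorph (CVec n) (CVec n)) : Prop where
  holomorphic : AnalyticOnNhd ℂ φ φ.source
  holomorphic_symm : AnalyticOnNhd ℂ φ.symm φ.target

lemma IsBiholomorphic.symm (h : IsBiholomorphic φ) : IsBiholomorphic φ.symm where
  holomorphic := h.holomorphic_symm
  holomorphic_symm := by simpa using h.holomorphic

lemma IsChartAt.isBiholomorphic {p : CVec n} (h : IsChartAt φ D p) : IsBiholomorphic φ :=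
  ⟨h.holomorphic, h.holomorphic_symm⟩

lemma fderiv_comp_fderiv_symm (hφ : IsBiholomorphic φ) {w : CVec n} (hw : w ∈ φ.target)
    (a : CVec n) : fderiv ℂ φ (φ.symm w) (fderiv ℂ φ.symm w a) = a := by
  have h1 := (hφ.holomorphic_symm w hw).differentiableAt
  have h2 := (hφ.holomorphic _ (φ.map_target hw)).differentiableAt
  have h3 : (φ ∘ φ.symm) =ᶠ[nhds w] id := by
    filter_upwards [φ.open_target.mem_nhds hw] with y hy using φ.right_inv hy
  have := h3.fderiv_eq (𝕜 := ℂ)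
  rw [fderiv_comp w h2 h1, fderiv_id] at this
  exact congrArg (fun T => T a) this

lemma fderiv_symm_comp_fderiv (hφ : IsBiholomorphic φ) {w : CVec n} (hw : w ∈ φ.target)
    (a : CVec n) : fderiv ℂ φ.symm w (fderiv ℂ φ (φ.symm w) a) = a := by
  have := fderiv_comp_fderiv_symm hφ.symm (w := φ.symm w) (φ.map_target hw) a
  simpa [φ.right_inv hw] using this

lemma tangentLift_mem (hφ : IsBiholomorphic φ) (hx : x ∈ slit φ.target) :
    tangentLift φ x ∈ slit φ.source := by
  refine ⟨φ.map_target hx.1, fun h => hx.2 ?_⟩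
  rw [← fderiv_comp_fderiv_symm hφ hx.1 x.2]
  exact (congrArg _ h).trans (map_zero _)

lemma tangentLift_symm_tangentLift (hφ : IsBiholomorphic φ) (hx : x ∈ slit φ.target) :
    tangentLift φ.symm (tangentLift φ x) = x :=
  Prod.ext (φ.right_inv hx.1) (fderiv_comp_fderiv_symm hφ hx.1 x.2)

lemma contDiffAt_tangentLift (hφ : IsBiholomorphic φ) (hx : x.1 ∈ φ.target) :
    ContDiffAt ℂ ∞ (tangentLift φ) x := by
  have h1 : ContDiffAt ℂ ∞ φ.symm x.1 := (hφ.holomorphic_symm _ hx).contDiffAt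
  have h2 : ContDiffAt ℂ ∞ (fderiv ℂ φ.symm) x.1 := h1.fderiv_right (by simp)
  exact (h1.comp x contDiffAt_fst).prodMk ((h2.comp x contDiffAt_fst).clm_apply contDiffAt_snd)

lemma differentiableAt_tangentLift (hφ : IsBiholomorphic φ) (hx : x.1 ∈ φ.target) :
    DifferentiableAt ℂ (tangentLift φ) x :=
  (contDiffAt_tangentLift hφ hx).differentiableAt (by simp)

lemma differentiableAt_fderiv_symm (hφ : IsBiholomorphic φ) (hx : x.1 ∈ φ.target) :
    DifferentiableAt ℂ (fun y : TVec n => fderiv ℂ φ.symm y.1) x :=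
  DifferentiableAt.comp (g := fderiv ℂ φ.symm) x
    ((hφ.holomorphic_symm.fderiv) _ hx).differentiableAt differentiableAt_fst

/-- The second derivative of the inverse chart, `∂²z^i/∂w^j∂w^k a^j b^k`. -/
def hess (φ : OpenPartialHomeomorph (CVec n) (CVec n)) (w a b : CVec n) : CVec n :=
  fderiv ℂ (fderiv ℂ φ.symm) w a b

lemma hess_symm (hφ : IsBiholomorphic φ) {w : CVec n} (hw : w ∈ φ.target) (a b : CVec n) :
    hess φ w a b = hess φ w b a :=
  ((hφ.holomorphic_symm w hw).contDiffAt (n := ω)).isSymmSndFDerivAt_of_omega a b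

/-- A horizontal direction acquires a vertical Hessian component; every inhomogeneous term below
originates here. -/
lemma fderiv_tangentLift (hφ : IsBiholomorphic φ) (hx : x.1 ∈ φ.target) (a b : CVec n) :
    fderiv ℂ (tangentLift φ) x (a, b)
      = (fderiv ℂ φ.symm x.1 a, hess φ x.1 a x.2 + fderiv ℂ φ.symm x.1 b) := by
  have h1 := (hφ.holomorphic_symm _ hx).differentiableAt.hasFDerivAt
  have h2 := ((hφ.holomorphic_symm.fderiv) _ hx).differentiableAt.hasFDerivAt
  have h3 := (HasFDerivAt.comp (g := φ.symm) x h1 (hasFDerivAt_fst (p := x))).prodMk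
    ((HasFDerivAt.comp (g := fderiv ℂ φ.symm) x h2 (hasFDerivAt_fst (p := x))).clm_apply
      (hasFDerivAt_snd (p := x)))
  have h4 : HasFDerivAt (tangentLift φ) _ x := h3
  rw [h4.fderiv]
  simp [hess, add_comm]

lemma fderiv_symm_eq_sum (w a : CVec n) (k : Fin n) :
    fderiv ℂ φ.symm w a k = ∑ i, a i * fderiv ℂ φ.symm w (Pi.single i 1) k := by
  conv_lhs => rw [vec_eq_sum a]
  simp

lemma holomorphic_jacobian (hφ : IsBiholomorphic φ) (hx : x.1 ∈ φ.target) (a : CVec n)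
    (k : Fin n) : DifferentiableAt ℂ (fun y : TVec n => fderiv ℂ φ.symm y.1 a k) x :=
  differentiableAt_pi.1
    ((differentiableAt_fderiv_symm hφ hx).clm_apply (differentiableAt_const a)) k

lemma wirt_jacobian_vertical (hφ : IsBiholomorphic φ) (hx : x.1 ∈ φ.target) (a b : CVec n)
    (k : Fin n) : wirt (0, b) (fun y : TVec n => fderiv ℂ φ.symm y.1 a k) x = 0 := by
  have h : (fun y : TVec n => fderiv ℂ φ.symm y.1 a k)
      = (fun w => fderiv ℂ φ.symm w a k) ∘ Prod.fst := rfl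
  have hd : DifferentiableAt ℂ (fun w => fderiv ℂ φ.symm w a k) x.1 :=
    differentiableAt_pi.1 (((hφ.holomorphic_symm.fderiv) _ hx).differentiableAt.clm_apply
      (differentiableAt_const a)) k
  rw [wirt_of_holomorphic (holomorphic_jacobian hφ hx a k), h,
    fderiv_comp x hd differentiableAt_fst]
  simp [fderiv_fst]

lemma contDiffAt_inChart_comp {f : TVec n → ℂ} (hφ : IsBiholomorphic φ) (hx : x.1 ∈ φ.target)
    (hf : ContDiffAt ℝ ∞ f (tangentLift φ x)) :
    ContDiffAt ℝ ∞ (fun y => f (tangentLift φ y)) x :=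
  hf.comp x ((contDiffAt_tangentLift hφ hx).restrict_scalars ℝ)

lemma energy_inChart : energy (inChart φ F) = fun y => energy F (tangentLift φ y) := rfl

lemma dEtaBar_energy_inChart (hφ : IsBiholomorphic φ)
    (hF : IsComplexFinslerMetric F φ.source) (hx : x ∈ slit φ.target) (m : Fin n) :
    dEtaBar m (energy (inChart φ F)) x
      = ∑ k, conj (fderiv ℂ φ.symm x.1 (Pi.single m 1) k)
          * dEtaBar k (energy F) (tangentLift φ x) := by
  rw [energy_inChart, dEtaBar, wirtBar_comp (differentiableAt_tangentLift hφ hx.1)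
    (diff_of_smooth (contDiffAt_energy φ.open_source hF (tangentLift_mem hφ hx))),
    fderiv_tangentLift hφ hx.1]
  simp only [map_zero, hess, zero_apply, zero_add]
  rw [wirtBar_eq_sum_dEtaBar]

/-- The conjugate Jacobian is antiholomorphic, so a derivative of type `(1,0)` acts on the other
factor only. The laws for `g`, the spray and `θ*` are instances with different `v`. -/
lemma wirt_dEtaBar_energy_inChart (hφ : IsBiholomorphic φ)
    (hF : IsComplexFinslerMetric F φ.source) (hx : x ∈ slit φ.target) (m : Fin n) (v : TVec n) :
    wirt v (dEtaBar m (energy (inChart φ F))) x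
      = ∑ k, conj (fderiv ℂ φ.symm x.1 (Pi.single m 1) k)
          * wirt (fderiv ℂ (tangentLift φ) x v) (dEtaBar k (energy F)) (tangentLift φ x) := by
  have e : dEtaBar m (energy (inChart φ F)) =ᶠ[nhds x] fun y =>
      ∑ k, conj (fderiv ℂ φ.symm y.1 (Pi.single m 1) k)
          * dEtaBar k (energy F) (tangentLift φ y) := by
    filter_upwards [slit_mem_nhds φ.open_target hx] with y hy
    exact dEtaBar_energy_inChart hφ hF hy m
  have hL := fun k => contDiffAt_dEtaBar_energy φ.open_source hF (tangentLift_mem hφ hx) k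
  have h1 : ∀ k, DifferentiableAt ℝ
      (fun y : TVec n => conj (fderiv ℂ φ.symm y.1 (Pi.single m 1) k)) x := fun k =>
    Complex.conjCLE.differentiableAt.comp (g := Complex.conjCLE) x
      ((holomorphic_jacobian hφ hx.1 (Pi.single m 1) k).restrictScalars ℝ)
  have h2 : ∀ k, DifferentiableAt ℝ (fun y => dEtaBar k (energy F) (tangentLift φ y)) x :=
    fun k => diff_of_smooth (contDiffAt_inChart_comp hφ hx.1 (hL k))
  rw [wirt_congr e, wirt_sum fun k _ => (h1 k).fun_mul (h2 k)]
  refine Finset.sum_congr rfl fun k _ => ?_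
  rw [wirt_mul (h1 k) (h2 k), wirt_conj,
    wirtBar_of_holomorphic (holomorphic_jacobian hφ hx.1 _ k), map_zero, zero_mul, zero_add,
    wirt_comp (differentiableAt_tangentLift hφ hx.1) (diff_of_smooth (hL k))]

/-- By linearity the basis vectors may be replaced by any vector, in particular by the preimage of
`e_j` under the Jacobian. -/
lemma eq_zero_of_conj_jacobian (hφ : IsBiholomorphic φ) {w : CVec n} (hw : w ∈ φ.target)
    {c : Fin n → ℂ} (h : ∀ m, ∑ k, conj (fderiv ℂ φ.symm w (Pi.single m 1) k) * c k = 0)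
    (j : Fin n) : c j = 0 := by
  have h1 : ∀ a : CVec n, ∑ k, conj (fderiv ℂ φ.symm w a k) * c k = 0 := fun a => by
    simp only [fderiv_symm_eq_sum w a, map_sum, map_mul, Finset.sum_mul]
    rw [Finset.sum_comm]
    refine Finset.sum_eq_zero fun m _ => ?_
    simp only [mul_assoc, ← Finset.mul_sum, h m, mul_zero]
  have h2 := h1 (fderiv ℂ φ (φ.symm w) (Pi.single j 1))
  rw [fderiv_symm_comp_fderiv hφ hw] at h2
  simpa [Pi.single_apply, apply_ite] using h2

/-- Vectors are determined by their contractions with the fundamental tensor. -/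
lemma eq_zero_of_wirt_dEtaBar (hF : IsComplexFinslerMetric F D) (hx : x ∈ slit D) {u : CVec n}
    (h : ∀ k, wirt (0, u) (dEtaBar k (energy F)) x = 0) : u = 0 := by
  refine eq_zero_of_gMat hF hx fun m => ?_
  rw [← h m, wirt_eq_sum_dEta]
  exact Finset.sum_congr rfl fun _ _ => mul_comm _ _

lemma gMat_inChart (hφ : IsBiholomorphic φ) (hF : IsComplexFinslerMetric F φ.source)
    (hx : x ∈ slit φ.target) (i m : Fin n) :
    gMat (inChart φ F) x i m = ∑ k, conj (fderiv ℂ φ.symm x.1 (Pi.single m 1) k)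
      * ∑ p, fderiv ℂ φ.symm x.1 (Pi.single i 1) p * gMat F (tangentLift φ x) p k := by
  rw [gMat_apply, dEta, wirt_dEtaBar_energy_inChart hφ hF hx]
  refine Finset.sum_congr rfl fun k _ => ?_
  rw [fderiv_tangentLift hφ hx.1]
  simp only [map_zero, hess, zero_apply, zero_add]
  rw [wirt_eq_sum_dEta]
  rfl

lemma posDef_gMat_inChart (hφ : IsBiholomorphic φ) (hF : IsComplexFinslerMetric F φ.source)
    (hx : x ∈ slit φ.target) : (gMat (inChart φ F) x).PosDef := by
  -- The conjugate is needed because the row index of `g` is the holomorphic one, so the congruence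
  -- takes the form `Bᴴ g B`.
  let B : Matrix (Fin n) (Fin n) ℂ :=
    Matrix.of fun p i => conj (fderiv ℂ φ.symm x.1 (Pi.single i 1) p)
  have hB : Function.Injective B.mulVec := by
    rw [← Matrix.coe_mulVecLin, ← LinearMap.ker_eq_bot, LinearMap.ker_eq_bot']
    intro v hv
    have h1 : fderiv ℂ φ.symm x.1 (fun i => conj (v i)) = 0 := by
      ext p
      have := congrArg conj (congrFun hv p)
      simp only [Matrix.mulVecLin_apply, Matrix.mulVec, dotProduct, B, Matrix.of_apply, map_sum,
        map_mul, Complex.conj_conj, Pi.zero_apply, map_zero] at this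
      rw [fderiv_symm_eq_sum, Pi.zero_apply, ← this]
      exact Finset.sum_congr rfl fun _ _ => mul_comm _ _
    have h2 := fderiv_comp_fderiv_symm hφ hx.1 (fun i => conj (v i))
    rw [h1, map_zero] at h2
    ext i
    simpa using (congrFun h2 i).symm
  have hg : gMat (inChart φ F) x = B.conjTranspose * gMat F (tangentLift φ x) * B := by
    ext i m
    rw [gMat_inChart hφ hF hx, Matrix.mul_apply]
    refine Finset.sum_congr rfl fun k _ => ?_
    rw [Matrix.mul_apply, mul_comm]
    simp [B, Matrix.conjTranspose_apply]
  rw [hg]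
  exact (hF.posDef _ (tangentLift_mem hφ hx)).conjTranspose_mul_mul_same hB

lemma isComplexFinslerMetric_inChart (hφ : IsBiholomorphic φ)
    (hF : IsComplexFinslerMetric F φ.source) :
    IsComplexFinslerMetric (inChart φ F) φ.target where
  continuousOn := by
    refine hF.continuousOn.comp (f := tangentLift φ) (fun x hx => ?_)
      fun x hx => ⟨φ.map_target hx.1, trivial⟩
    exact (differentiableAt_tangentLift hφ hx.1).continuousAt.continuousWithinAt
  smooth := fun x hx => ContDiffAt.contDiffWithinAt <|
    (contDiffAt_metric φ.open_source hF (tangentLift_mem hφ hx)).comp x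
      ((contDiffAt_tangentLift hφ hx.1).restrict_scalars ℝ)
  nonneg z hz η := hF.nonneg _ (φ.map_target hz) _
  eq_zero_iff z hz η := by
    refine (hF.eq_zero_iff _ (φ.map_target hz) _).trans ⟨fun h => ?_, fun h => ?_⟩
    · have := fderiv_comp_fderiv_symm hφ hz η
      rw [← this]
      exact (congrArg _ h).trans (map_zero _)
    · simp [h]
  homogeneous z hz c η := by
    rw [inChart_apply, inChart_apply, tangentLift, tangentLift, map_smul]
    exact hF.homogeneous _ (φ.map_target hz) c _
  posDef x hx := posDef_gMat_inChart hφ hF hx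

/-- Transformation law of the spray coefficients under a change of coordinates. -/
lemma fderiv_symm_spray_inChart (hφ : IsBiholomorphic φ) (hF : IsComplexFinslerMetric F φ.source)
    (hx : x ∈ slit φ.target) :
    fderiv ℂ φ.symm x.1 (fun i => spray (inChart φ F) i x)
      = (fun i => spray F i (tangentLift φ x)) + (1 / 2 : ℂ) • hess φ x.1 x.2 x.2 := by
  have hΨ := tangentLift_mem hφ hx
  have hF' := isComplexFinslerMetric_inChart hφ hF
  rw [← sub_eq_zero]
  -- The identity is tested after lowering the index with `g` and contracting with the conjugate
  -- Jacobian, both invertible.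
  refine eq_zero_of_wirt_dEtaBar hF hΨ (eq_zero_of_conj_jacobian hφ hx.1 fun m => ?_)
  have h1 := sum_gMat_mul_spray φ.open_target hF' hx m
  have h2 : ∑ i, gMat (inChart φ F) x i m * spray (inChart φ F) i x
      = wirt (0, fun i => spray (inChart φ F) i x) (dEtaBar m (energy (inChart φ F))) x := by
    rw [wirt_eq_sum_dEta]
    exact Finset.sum_congr rfl fun _ _ => mul_comm _ _
  rw [h2, wirt_dEtaBar_energy_inChart hφ hF hx, wirt_dEtaBar_energy_inChart hφ hF hx,
    fderiv_tangentLift hφ hx.1, fderiv_tangentLift hφ hx.1] at h1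
  simp only [map_zero, hess, zero_apply, zero_add, add_zero] at h1
  -- The lifted direction splits: its horizontal part gives `2G` of `F` by `sum_gMat_mul_spray`, its
  -- vertical part is the Hessian term.
  have h3 : ∀ k, wirt (fderiv ℂ φ.symm x.1 x.2, fderiv ℂ (fderiv ℂ φ.symm) x.1 x.2 x.2)
      (dEtaBar k (energy F)) (tangentLift φ x)
      = wirt (0, (2 : ℂ) • ((fun i => spray F i (tangentLift φ x))
        + (1 / 2 : ℂ) • hess φ x.1 x.2 x.2)) (dEtaBar k (energy F)) (tangentLift φ x) := fun k => by
    have h4 : ∑ i, gMat F (tangentLift φ x) i k * spray F i (tangentLift φ x)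
        = wirt (0, fun i => spray F i (tangentLift φ x)) (dEtaBar k (energy F))
          (tangentLift φ x) := by
      rw [wirt_eq_sum_dEta]
      exact Finset.sum_congr rfl fun _ _ => mul_comm _ _
    have h5 := sum_gMat_mul_spray φ.open_source hF hΨ k
    rw [h4] at h5
    rw [wirt_prod, show wirt (fderiv ℂ φ.symm x.1 x.2, 0) (dEtaBar k (energy F)) (tangentLift φ x)
      = 2 * wirt (0, fun i => spray F i (tangentLift φ x)) (dEtaBar k (energy F))
          (tangentLift φ x) from h5.symm, ← wirt_smul_dir, ← wirt_add_dir, smul_add, smul_smul]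
    simp [hess]
  simp only [h3] at h1
  have h6 : ∀ a b : CVec n, ((0, a - b) : TVec n) = (0, a) + (-(1 / 2) : ℂ) • (0, (2 : ℂ) • b) :=
    fun a b => by
      ext i
      · simp
      · simp; ring
  simp only [h6, wirt_add_dir, wirt_smul_dir (-(1 / 2) : ℂ), mul_add, Finset.sum_add_distrib]
  have h7 : ∀ (c d : Fin n → ℂ), ∑ i, c i * (-(1 / 2) * d i) = -(1 / 2) * ∑ i, c i * d i :=
    fun c d => by
      rw [Finset.mul_sum]
      exact Finset.sum_congr rfl fun _ _ => by ring
  rw [h7, ← h1]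
  ring

end Charts
-- Independence of the chart: Berwald condition, Kähler form, projective relation
section Invariance

variable {φ : OpenPartialHomeomorph (CVec n) (CVec n)} {D : Set (CVec n)} {F F' : TVec n → ℝ}
  {x : TVec n}

/-- The map is quadratic in `η`; symmetry of the Hessian merges its two vertical derivatives into
the factor `2`. -/
lemma hasFDerivAt_hess (hφ : IsBiholomorphic φ) (hx : x.1 ∈ φ.target) :
    ∃ T : TVec n →L[ℂ] CVec n, HasFDerivAt (fun y : TVec n => hess φ y.1 y.2 y.2) T x ∧
      ∀ b, T (0, b) = (2 : ℂ) • hess φ x.1 b x.2 := by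
  have h2 := ((hφ.holomorphic_symm.fderiv).fderiv _ hx).differentiableAt.hasFDerivAt
  have h3 := HasFDerivAt.comp (g := fderiv ℂ (fderiv ℂ φ.symm)) x h2 (hasFDerivAt_fst (p := x))
  have h4 := (h3.clm_apply (hasFDerivAt_snd (p := x))).clm_apply (hasFDerivAt_snd (p := x))
  refine ⟨_, h4, fun b => ?_⟩
  have := hess_symm hφ hx x.2 b
  simp only [hess] at this
  simp [hess, this, two_smul]

lemma holomorphic_hess_apply (hφ : IsBiholomorphic φ) (hx : x.1 ∈ φ.target) (p : Fin n) :
    DifferentiableAt ℂ (fun y : TVec n => hess φ y.1 y.2 y.2 p) x := by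
  obtain ⟨T, hT, -⟩ := hasFDerivAt_hess hφ hx
  exact (hasFDerivAt_pi'.1 hT p).differentiableAt

lemma wirt_hess_apply (hφ : IsBiholomorphic φ) (hx : x.1 ∈ φ.target) (p : Fin n) (b : CVec n) :
    wirt (0, b) (fun y : TVec n => hess φ y.1 y.2 y.2 p) x = 2 * hess φ x.1 b x.2 p := by
  obtain ⟨T, hT, hb⟩ := hasFDerivAt_hess hφ hx
  rw [wirt_of_holomorphic (holomorphic_hess_apply hφ hx p), (hasFDerivAt_pi'.1 hT p).fderiv]
  simp [hb]

lemma sum_jacobian_mul_spray_inChart (hφ : IsBiholomorphic φ)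
    (hF : IsComplexFinslerMetric F φ.source) (hx : x ∈ slit φ.target) (p : Fin n) :
    ∑ i, spray (inChart φ F) i x * fderiv ℂ φ.symm x.1 (Pi.single i 1) p
      = spray F p (tangentLift φ x) + (1 / 2) * hess φ x.1 x.2 x.2 p := by
  rw [← fderiv_symm_eq_sum x.1 (fun i => spray (inChart φ F) i x),
    fderiv_symm_spray_inChart hφ hF hx]
  simp

/-- The Hessian term and the Jacobian are holomorphic, so `∂/∂η̄` annihilates both and the law is
homogeneous. -/
lemma fderiv_symm_dEtaBar_spray_inChart (hφ : IsBiholomorphic φ)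
    (hF : IsComplexFinslerMetric F φ.source) (hx : x ∈ slit φ.target) (h p : Fin n) :
    fderiv ℂ φ.symm x.1 (fun i => dEtaBar h (spray (inChart φ F) i) x) p
      = wirtBar (0, fderiv ℂ φ.symm x.1 (Pi.single h 1)) (spray F p) (tangentLift φ x) := by
  have hF' := isComplexFinslerMetric_inChart hφ hF
  have hG : ∀ i, DifferentiableAt ℝ (spray (inChart φ F) i) x := fun i =>
    diff_of_smooth (contDiffAt_spray φ.open_target hF' hx i)
  have hJ : ∀ i, DifferentiableAt ℝ
      (fun y : TVec n => fderiv ℂ φ.symm y.1 (Pi.single i 1) p) x := fun i =>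
    (holomorphic_jacobian hφ hx.1 _ p).restrictScalars ℝ
  have hGF := contDiffAt_spray φ.open_source hF (tangentLift_mem hφ hx) p
  have hH := holomorphic_hess_apply hφ hx.1 p
  have e : (fun y => ∑ i, spray (inChart φ F) i y * fderiv ℂ φ.symm y.1 (Pi.single i 1) p)
      =ᶠ[nhds x] fun y => spray F p (tangentLift φ y) + (1 / 2) * hess φ y.1 y.2 y.2 p := by
    filter_upwards [slit_mem_nhds φ.open_target hx] with y hy
    exact sum_jacobian_mul_spray_inChart hφ hF hy p
  have e1 := wirtBar_congr (v := (0, Pi.single h 1)) e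
  rw [wirtBar_sum fun i _ => (hG i).fun_mul (hJ i),
    wirtBar_add (diff_of_smooth (contDiffAt_inChart_comp hφ hx.1 hGF))
      ((hH.restrictScalars ℝ).const_mul _), wirtBar_const_mul _ (hH.restrictScalars ℝ),
    wirtBar_of_holomorphic hH, mul_zero, add_zero,
    wirtBar_comp (differentiableAt_tangentLift hφ hx.1) (diff_of_smooth hGF),
    fderiv_tangentLift hφ hx.1] at e1
  simp only [map_zero, hess, zero_apply, zero_add] at e1
  rw [← e1, fderiv_symm_eq_sum]
  refine Finset.sum_congr rfl fun i _ => ?_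
  rw [wirtBar_mul (hG i) (hJ i), wirtBar_of_holomorphic (holomorphic_jacobian hφ hx.1 _ p),
    mul_zero, add_zero, dEtaBar]

/-- Here the Hessian term survives; it is the one that has to cancel in the Kähler form. -/
lemma fderiv_symm_dEta_spray_inChart (hφ : IsBiholomorphic φ)
    (hF : IsComplexFinslerMetric F φ.source) (hx : x ∈ slit φ.target) (h p : Fin n) :
    fderiv ℂ φ.symm x.1 (fun i => dEta h (spray (inChart φ F) i) x) p
      = wirt (0, fderiv ℂ φ.symm x.1 (Pi.single h 1)) (spray F p) (tangentLift φ x)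
        + hess φ x.1 (Pi.single h 1) x.2 p := by
  have hF' := isComplexFinslerMetric_inChart hφ hF
  have hG : ∀ i, DifferentiableAt ℝ (spray (inChart φ F) i) x := fun i =>
    diff_of_smooth (contDiffAt_spray φ.open_target hF' hx i)
  have hJ : ∀ i, DifferentiableAt ℝ
      (fun y : TVec n => fderiv ℂ φ.symm y.1 (Pi.single i 1) p) x := fun i =>
    (holomorphic_jacobian hφ hx.1 _ p).restrictScalars ℝ
  have hGF := contDiffAt_spray φ.open_source hF (tangentLift_mem hφ hx) p
  have hH := holomorphic_hess_apply hφ hx.1 p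
  have e : (fun y => ∑ i, spray (inChart φ F) i y * fderiv ℂ φ.symm y.1 (Pi.single i 1) p)
      =ᶠ[nhds x] fun y => spray F p (tangentLift φ y) + (1 / 2) * hess φ y.1 y.2 y.2 p := by
    filter_upwards [slit_mem_nhds φ.open_target hx] with y hy
    exact sum_jacobian_mul_spray_inChart hφ hF hy p
  have e1 := wirt_congr (v := (0, Pi.single h 1)) e
  rw [wirt_sum fun i _ => (hG i).fun_mul (hJ i),
    wirt_add (diff_of_smooth (contDiffAt_inChart_comp hφ hx.1 hGF))
      ((hH.restrictScalars ℝ).const_mul _), wirt_const_mul _ (hH.restrictScalars ℝ),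
    wirt_hess_apply hφ hx.1,
    wirt_comp (differentiableAt_tangentLift hφ hx.1) (diff_of_smooth hGF),
    fderiv_tangentLift hφ hx.1, map_zero, show hess φ x.1 0 x.2 = 0 by simp [hess], zero_add] at e1
  rw [show hess φ x.1 (Pi.single h 1) x.2 p = 1 / 2 * (2 * hess φ x.1 (Pi.single h 1) x.2 p) by
    ring, ← e1, fderiv_symm_eq_sum]
  refine Finset.sum_congr rfl fun i _ => ?_
  rw [wirt_mul (hG i) (hJ i), wirt_jacobian_vertical hφ hx.1, mul_zero, add_zero, dEta]

lemma isGeneralizedBerwald_inChart (hφ : IsBiholomorphic φ)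
    (hF : IsComplexFinslerMetric F φ.source) (h : IsGeneralizedBerwald F φ.source) :
    IsGeneralizedBerwald (inChart φ F) φ.target := by
  intro x hx i k
  have h1 : fderiv ℂ φ.symm x.1 (fun i => dEtaBar k (spray (inChart φ F) i) x) = 0 := by
    ext p
    rw [fderiv_symm_dEtaBar_spray_inChart hφ hF hx, wirtBar_eq_sum_dEtaBar]
    exact Finset.sum_eq_zero fun j _ => by rw [h _ (tangentLift_mem hφ hx), mul_zero]
  have h2 := fderiv_comp_fderiv_symm hφ hx.1 (fun i => dEtaBar k (spray (inChart φ F) i) x)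
  rw [h1, map_zero] at h2
  exact (congrFun h2 i).symm

/-- The Kähler form is a covector. -/
lemma kahlerForm_inChart (hφ : IsBiholomorphic φ) (hF : IsComplexFinslerMetric F φ.source)
    (hx : x ∈ slit φ.target) (k : Fin n) :
    kahlerForm (inChart φ F) k x
      = ∑ q, fderiv ℂ φ.symm x.1 (Pi.single k 1) q * kahlerForm F q (tangentLift φ x) := by
  have hF' := isComplexFinslerMetric_inChart hφ hF
  have hΨ := tangentLift_mem hφ hx
  have hE := diff_of_smooth (contDiffAt_energy φ.open_source hF hΨ)
  have e0 : ∀ v, wirt v (energy (inChart φ F)) x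
      = wirt (fderiv ℂ (tangentLift φ) x v) (energy F) (tangentLift φ x) := fun v =>
    wirt_comp (differentiableAt_tangentLift hφ hx.1) hE
  have e1 : dz k (energy (inChart φ F)) x
      = wirt (fderiv ℂ φ.symm x.1 (Pi.single k 1), 0) (energy F) (tangentLift φ x)
        + wirt (0, hess φ x.1 (Pi.single k 1) x.2) (energy F) (tangentLift φ x) := by
    rw [dz, e0, fderiv_tangentLift hφ hx.1, map_zero, add_zero, wirt_prod]
  have e2 : ∑ i, dEta i (energy (inChart φ F)) x * dEta k (spray (inChart φ F) i) x
      = wirt (0, fun p => wirt (0, fderiv ℂ φ.symm x.1 (Pi.single k 1)) (spray F p)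
          (tangentLift φ x)) (energy F) (tangentLift φ x)
        + wirt (0, hess φ x.1 (Pi.single k 1) x.2) (energy F) (tangentLift φ x) := by
    have : ∑ i, dEta i (energy (inChart φ F)) x * dEta k (spray (inChart φ F) i) x
        = wirt (0, fun i => dEta k (spray (inChart φ F) i) x) (energy (inChart φ F)) x := by
      rw [wirt_eq_sum_dEta]
      exact Finset.sum_congr rfl fun _ _ => mul_comm _ _
    rw [this, e0, fderiv_tangentLift hφ hx.1, map_zero,
      show hess φ x.1 0 x.2 = 0 by simp [hess], zero_add, ← wirt_add_dir]
    congr 1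
    rw [Prod.mk_add_mk, add_zero]
    congr 1
    ext p
    exact fderiv_symm_dEta_spray_inChart hφ hF hx k p
  rw [kahlerForm_eq φ.open_target hF' hx, e1, e2]
  simp only [kahlerForm_eq φ.open_source hF hΨ, wirt_eq_sum_dz, wirt_eq_sum_dEta, Finset.sum_mul]
  rw [Finset.sum_comm (s := Finset.univ) (t := Finset.univ)]
  -- The Hessian terms of `e1` and `e2` are equal and cancel.
  rw [add_sub_add_right_eq_sub, ← Finset.sum_sub_distrib, Finset.mul_sum]
  refine Finset.sum_congr rfl fun q _ => ?_
  simp only [mul_sub, Finset.mul_sum]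
  congr 1
  · ring
  · exact Finset.sum_congr rfl fun _ _ => by ring

lemma isWeaklyKahler_iff : IsWeaklyKahler F D ↔ ∀ x ∈ slit D, ∀ k, kahlerForm F k x = 0 :=
  Iff.rfl

lemma isComplexBerwald_inChart (hφ : IsBiholomorphic φ)
    (hF : IsComplexFinslerMetric F φ.source) (h : IsComplexBerwald F φ.source) :
    IsComplexBerwald (inChart φ F) φ.target := by
  refine ⟨isGeneralizedBerwald_inChart hφ hF h.1, isWeaklyKahler_iff.2 fun x hx k => ?_⟩
  rw [kahlerForm_inChart hφ hF hx]
  exact Finset.sum_eq_zero fun q _ => by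
    rw [isWeaklyKahler_iff.1 h.2 _ (tangentLift_mem hφ hx), mul_zero]

/-- With its index lowered, `θ*` is the conjugate of the Kähler form, which is a covector; hence
`θ*` is a vector. -/
lemma fderiv_symm_thetaStar_inChart (hφ : IsBiholomorphic φ)
    (hF : IsComplexFinslerMetric F φ.source) (hx : x ∈ slit φ.target) :
    fderiv ℂ φ.symm x.1 (fun i => thetaStar (inChart φ F) i x)
      = fun i => thetaStar F i (tangentLift φ x) := by
  have hΨ := tangentLift_mem hφ hx
  have hF' := isComplexFinslerMetric_inChart hφ hF
  rw [← sub_eq_zero]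
  refine eq_zero_of_wirt_dEtaBar hF hΨ (eq_zero_of_conj_jacobian hφ hx.1 fun m => ?_)
  have h1 := sum_gMat_mul_thetaStar hF' hx m
  have h2 : ∑ i, gMat (inChart φ F) x i m * thetaStar (inChart φ F) i x
      = wirt (0, fun i => thetaStar (inChart φ F) i x) (dEtaBar m (energy (inChart φ F))) x := by
    rw [wirt_eq_sum_dEta]
    exact Finset.sum_congr rfl fun _ _ => mul_comm _ _
  have h3 : ∀ k, wirt (0, fun i => thetaStar F i (tangentLift φ x)) (dEtaBar k (energy F))
      (tangentLift φ x) = conj (kahlerForm F k (tangentLift φ x)) := fun k => by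
    rw [← sum_gMat_mul_thetaStar hF hΨ, wirt_eq_sum_dEta]
    exact Finset.sum_congr rfl fun _ _ => mul_comm _ _
  rw [h2, wirt_dEtaBar_energy_inChart hφ hF hx, fderiv_tangentLift hφ hx.1, map_zero,
    show hess φ x.1 0 x.2 = 0 by simp [hess], zero_add, kahlerForm_inChart hφ hF hx, map_sum] at h1
  have h4 : ∀ a b : CVec n, ((0, a - b) : TVec n) = (0, a) + (-1 : ℂ) • (0, b) := fun a b => by
    ext i
    · simp
    · simp; ring
  simp only [h4, wirt_add_dir, wirt_smul_dir (-1 : ℂ), h3, mul_add, Finset.sum_add_distrib, h1]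
  simp

/-- Both sprays carry the same Hessian term, so their difference is a vector, like `θ*` and `η`. The
factor `P` is pulled back. -/
lemma projectivelyRelated_inChart (hφ : IsBiholomorphic φ)
    (hF : IsComplexFinslerMetric F φ.source) (hF' : IsComplexFinslerMetric F' φ.source)
    (h : ProjectivelyRelated F F' φ.source) :
    ProjectivelyRelated (inChart φ F) (inChart φ F') φ.target := by
  obtain ⟨P, hP, hG⟩ := h
  refine ⟨fun x => P (tangentLift φ x), fun x hx => ContDiffAt.contDiffWithinAt <|
    contDiffAt_inChart_comp hφ hx.1 (hP.contDiffAt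
      (slit_mem_nhds φ.open_source (tangentLift_mem hφ hx))), fun x hx i => ?_⟩
  have h1 : (fun i => spray (inChart φ F') i x) = (fun i => spray (inChart φ F) i x)
      + (1 / 2 : ℂ) • ((fun i => thetaStar (inChart φ F') i x)
        - fun i => thetaStar (inChart φ F) i x) + P (tangentLift φ x) • x.2 := by
    rw [← fderiv_comp_fderiv_symm hφ hx.1 (fun i => spray (inChart φ F') i x),
      ← fderiv_comp_fderiv_symm hφ hx.1 (_ + _)]
    congr 1
    simp only [map_add, map_smul, map_sub, fderiv_symm_thetaStar_inChart hφ hF hx,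
      fderiv_symm_thetaStar_inChart hφ hF' hx, fderiv_symm_spray_inChart hφ hF hx,
      fderiv_symm_spray_inChart hφ hF' hx]
    ext p
    have := hG _ (tangentLift_mem hφ hx) p
    have e : (tangentLift φ x).2 = fderiv ℂ φ.symm x.1 x.2 := rfl
    rw [e] at this
    simp only [Pi.add_apply, Pi.smul_apply, Pi.sub_apply, smul_eq_mul, this]
    ring
  simpa using congrFun h1 i

end Invariance

/-! ### Dependence on germs and restriction to smaller sets -/

section Locality

variable {D U : Set (CVec n)} {F F' F₁ F₁' : TVec n → ℝ} {x : TVec n}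

lemma gMat_eventuallyEq (h : F =ᶠ[nhds x] F₁) : gMat F =ᶠ[nhds x] gMat F₁ := by
  have hE : energy F =ᶠ[nhds x] energy F₁ := by
    filter_upwards [h] with y hy
    simp [energy, hy]
  have hg : ∀ i j, dEta i (dEtaBar j (energy F)) =ᶠ[nhds x] dEta i (dEtaBar j (energy F₁)) :=
    fun i j => wirt_eventuallyEq (wirtBar_eventuallyEq hE)
  have := Filter.eventually_all.2 fun i => Filter.eventually_all.2 fun j => hg i j
  filter_upwards [this] with y hy
  ext i j
  exact hy i j

lemma chernN_eventuallyEq (h : F =ᶠ[nhds x] F₁) (i j : Fin n) :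
    chernN F i j =ᶠ[nhds x] chernN F₁ i j := by
  have hg := gMat_eventuallyEq h
  filter_upwards [hg, hg.eventuallyEq_nhds] with y hy hy'
  have : ∀ l m, dz j (fun y => gMat F y l m) y = dz j (fun y => gMat F₁ y l m) y := fun l m =>
    wirt_congr (by filter_upwards [hy'] with z hz using by rw [hz])
  simp only [chernN, hy, this]

lemma spray_eventuallyEq (h : F =ᶠ[nhds x] F₁) (i : Fin n) :
    spray F i =ᶠ[nhds x] spray F₁ i := by
  have := Filter.eventually_all.2 fun j => chernN_eventuallyEq h i j
  filter_upwards [this] with y hy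
  simp only [spray, hy]

lemma torsion_congr (h : F =ᶠ[nhds x] F₁) (i j k : Fin n) :
    torsion F i j k x = torsion F₁ i j k x := by
  simp only [torsion, chernL, dEta, wirt_congr (chernN_eventuallyEq h _ _)]

lemma kahlerForm_congr (h : F =ᶠ[nhds x] F₁) (k : Fin n) :
    kahlerForm F k x = kahlerForm F₁ k x := by
  simp only [kahlerForm, torsion_congr h, (gMat_eventuallyEq h).eq_of_nhds]

lemma thetaStar_congr (h : F =ᶠ[nhds x] F₁) (k : Fin n) :
    thetaStar F k x = thetaStar F₁ k x := by
  simp only [thetaStar, torsion_congr h, (gMat_eventuallyEq h).eq_of_nhds]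

lemma eventuallyEq_of_eqOn_slit (hD : IsOpen D) (h : Set.EqOn F F₁ (slit D)) (hx : x ∈ slit D) :
    F =ᶠ[nhds x] F₁ :=
  h.eventuallyEq_of_mem (slit_mem_nhds hD hx)

lemma isComplexBerwald_congr (hD : IsOpen D) (h : Set.EqOn F F₁ (slit D))
    (hB : IsComplexBerwald F D) : IsComplexBerwald F₁ D := by
  refine ⟨fun x hx i k => ?_, isWeaklyKahler_iff.2 fun x hx k => ?_⟩
  · rw [← hB.1 x hx i k]
    exact (wirtBar_congr (spray_eventuallyEq (eventuallyEq_of_eqOn_slit hD h hx) i)).symm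
  · rw [← isWeaklyKahler_iff.1 hB.2 x hx k]
    exact (kahlerForm_congr (eventuallyEq_of_eqOn_slit hD h hx) k).symm

lemma isMinkowskiInCoords_congr (hD : IsOpen D) (h : Set.EqOn F F₁ (slit D))
    (hM : IsMinkowskiInCoords F D) : IsMinkowskiInCoords F₁ D := by
  intro z hz z' hz' η hη
  have e : ∀ w ∈ D, gMat F (w, η) = gMat F₁ (w, η) := fun w hw =>
    (gMat_eventuallyEq (eventuallyEq_of_eqOn_slit hD h ⟨hw, hη⟩)).eq_of_nhds
  rw [← e z hz, ← e z' hz', hM z hz z' hz' η hη]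

lemma projectivelyRelated_congr (hD : IsOpen D) (h : Set.EqOn F F₁ (slit D))
    (hP : ProjectivelyRelated F F' D) : ProjectivelyRelated F₁ F' D := by
  obtain ⟨P, hP, hG⟩ := hP
  refine ⟨P, hP, fun x hx i => ?_⟩
  have e := eventuallyEq_of_eqOn_slit hD h hx
  rw [hG x hx i, (spray_eventuallyEq e i).eq_of_nhds, thetaStar_congr e]

lemma IsComplexFinslerMetric.mono (hF : IsComplexFinslerMetric F D) (h : U ⊆ D) :
    IsComplexFinslerMetric F U where
  continuousOn := hF.continuousOn.mono (Set.prod_mono h subset_rfl)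
  smooth := hF.smooth.mono (slit_mono h)
  nonneg z hz := hF.nonneg z (h hz)
  eq_zero_iff z hz := hF.eq_zero_iff z (h hz)
  homogeneous z hz := hF.homogeneous z (h hz)
  posDef x hx := hF.posDef x (slit_mono h hx)

lemma IsComplexBerwald.mono (hB : IsComplexBerwald F D) (h : U ⊆ D) : IsComplexBerwald F U :=
  ⟨fun x hx => hB.1 x (slit_mono h hx), fun x hx => hB.2 x (slit_mono h hx)⟩

lemma ProjectivelyRelated.mono (hP : ProjectivelyRelated F F' D) (h : U ⊆ D) :
    ProjectivelyRelated F F' U :=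
  let ⟨P, hP, hG⟩ := hP
  ⟨P, hP.mono (slit_mono h), fun x hx => hG x (slit_mono h hx)⟩

end Locality

/-! ### Local projective flatness -/

section LocallyFlat

variable {φ : OpenPartialHomeomorph (CVec n) (CVec n)} {D : Set (CVec n)} {F : TVec n → ℝ}

/-- Agreement is claimed only over the source, where `φ` is invertible. Conclusions about `F` are
therefore transferred by the congruence lemmas, not by rewriting. -/
lemma inChart_symm_inChart (hφ : IsBiholomorphic φ) :
    Set.EqOn (inChart φ.symm (inChart φ F)) F (slit φ.source) := by
  intro x hx
  rw [inChart_apply, inChart_apply]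
  exact congrArg F (tangentLift_symm_tangentLift hφ.symm hx)

lemma isLocallyProjectivelyFlat_iff (hF : IsComplexFinslerMetric F D) :
    IsLocallyProjectivelyFlat F D ↔ IsComplexBerwald F D ∧
      ∀ p ∈ D, ∃ φ : OpenPartialHomeomorph (CVec n) (CVec n),
        IsChartAt φ D p ∧ SprayIdentity (inChart φ F) φ.target := by
  constructor
  · intro h
    -- In a chart flattening the Minkowski metric, the statement in coordinates applies. The Berwald
    -- property is then carried back to `F` by `φ.symm`; being a pointwise condition, it holds on
    -- all of `D`.
    have key : ∀ p ∈ D, ∃ φ : OpenPartialHomeomorph (CVec n) (CVec n), IsChartAt φ D p ∧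
        SprayIdentity (inChart φ F) φ.target ∧ IsComplexBerwald F φ.source := by
      intro p hp
      obtain ⟨U, -, hpU, hUD, F', hF', hM, hP⟩ := h p hp
      obtain ⟨φ, hc, hφM⟩ := hM p hpU
      have hφ := hc.isBiholomorphic
      have hFφ := hF.mono (hc.source_subset.trans hUD)
      have hFφ' := hF'.mono hc.source_subset
      have hFc := isComplexFinslerMetric_inChart hφ hFφ
      have h1 := (isProjectivelyFlatInCoords_iff φ.open_target hFc).1
        ⟨inChart φ F', isComplexFinslerMetric_inChart hφ hFφ', hφM,
          projectivelyRelated_inChart hφ hFφ hFφ' (hP.mono hc.source_subset)⟩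
      exact ⟨φ, ⟨hc.mem_source, hc.source_subset.trans hUD, hc.holomorphic, hc.holomorphic_symm⟩,
        h1.2, isComplexBerwald_congr φ.open_source (inChart_symm_inChart hφ)
          (isComplexBerwald_inChart hφ.symm hFc h1.1)⟩
    refine ⟨⟨fun x hx => ?_, fun x hx => ?_⟩, fun p hp => ?_⟩
    · obtain ⟨φ, hc, -, hB⟩ := key x.1 hx.1
      exact hB.1 x ⟨hc.mem_source, hx.2⟩
    · obtain ⟨φ, hc, -, hB⟩ := key x.1 hx.1
      exact hB.2 x ⟨hc.mem_source, hx.2⟩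
    · obtain ⟨φ, hc, hS, -⟩ := key p hp
      exact ⟨φ, hc, hS⟩
  · rintro ⟨hB, h⟩ p hp
    obtain ⟨φ, hc, hS⟩ := h p hp
    have hφ := hc.isBiholomorphic
    have hFφ := hF.mono hc.source_subset
    have hFc := isComplexFinslerMetric_inChart hφ hFφ
    have hE := isComplexFinslerMetric_euclid φ.target
    have hP := projectivelyRelated_euclid φ.open_target hFc
      (isComplexBerwald_inChart hφ hFφ (hB.mono hc.source_subset)).2 hS
    -- The witness is the Euclidean metric of the chart's target, pulled back to the source. The
    -- same `φ` serves as its flat chart around every point.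
    refine ⟨φ.source, φ.open_source, hc.mem_source, hc.source_subset, inChart φ.symm euclid,
      isComplexFinslerMetric_inChart hφ.symm hE, fun q hq => ⟨φ, ?_, ?_⟩,
      projectivelyRelated_congr φ.open_source (inChart_symm_inChart hφ)
        (projectivelyRelated_inChart hφ.symm hFc hE hP)⟩
    · exact ⟨hq, subset_rfl, hc.holomorphic, hc.holomorphic_symm⟩
    · exact isMinkowskiInCoords_congr φ.open_target (inChart_symm_inChart hφ.symm).symm
        (isMinkowskiInCoords_euclid _)

end LocallyFlat

end ComplexFinsler

end

theorem theorem2p4 (n : ℕ) (D : Set (ComplexFinsler.CVec n)) (hD : IsOpen D)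
    (F : ComplexFinsler.TVec n → ℝ) (hF : ComplexFinsler.IsComplexFinslerMetric F D) :
    (ComplexFinsler.IsProjectivelyFlatInCoords F D ↔
      ComplexFinsler.IsComplexBerwald F D ∧ ComplexFinsler.SprayIdentity F D) ∧
    (ComplexFinsler.IsLocallyProjectivelyFlat F D ↔
      ComplexFinsler.IsComplexBerwald F D ∧
        ∀ p ∈ D, ∃ φ : OpenPartialHomeomorph (ComplexFinsler.CVec n) (ComplexFinsler.CVec n),
          ComplexFinsler.IsChartAt φ D p ∧
            ComplexFinsler.SprayIdentity (ComplexFinsler.inChart φ F) φ.target) :=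
  ⟨ComplexFinsler.isProjectivelyFlatInCoords_iff hD hF,
    ComplexFinsler.isLocallyProjectivelyFlat_iff hF⟩
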